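/- **Setting.** Let $\Omega\subset\mathbb C$ be a bounded Borel set, $\lambda$ Lebesgue measure, $\mathcal C_1$ and $\mathcal C_2$ the trace class and the Hilbert--Schmidt class of $L^2(\Omega,\lambda)$, with norms $|T|_1=\operatorname{Tr}\,(T^*T)^{1/2}$ and $|T|_2=(\operatorname{Tr}\,T^*T)^{1/2}$ (each $=\infty$ off the class). For $f\in L^\infty(\Omega,\lambda)$ let $M_f$ be the operator of multiplication by $f$ on $L^2(\Omega,\lambda)$, let $Df(s,t)=\frac{f(s)-f(t)}{s-t}$ $(s\neq t)$, and let $\Lambda(\Omega)=\{f\in L^\infty(\Omega,\lambda): Df\in L^\infty(\Omega\times\Omega,\lambda\otimes\lambda)\}$. For a bounded operator $T$ on $L^2(\Omega,\lambda)$ put $$L(T)=\sup\{\,|[M_f,T]|_2 : f\in\Lambda(\Omega),\ \|Df\|_\infty\le 1\,\}.$$ Let $K\Lambda(\Omega)$ be the space of all compact operators $T$ on $L^2(\Omega,\lambda)$ with $L(T)<\infty$, with the norm $\|T\|+L(T)$, and let $Z$ be the operator of multiplication by the coordinate function $z$. Give $\mathcal C_1\times\mathcal C_2$ the norm $\max(|x|_1,|y|_2)$.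 **Proposition.** Let $$\mathcal N=\{([Z,H],H) : H\in\mathcal C_2,\ [Z,H]\in\mathcal C_1\}\subset \mathcal C_1\times\mathcal C_2 .$$ For all $T\in K\Lambda(\Omega)$ and $(x,y)\in\mathcal C_1\times\mathcal C_2$ the operator $Tx+[Z,T]y$ is of trace class, and the pairing $$(T,(x,y))\mapsto \operatorname{Tr}\,(Tx+[Z,T]\,y)$$ induces an isometric linear isomorphism of the quotient $(\mathcal C_1\times\mathcal C_2)/\mathcal N$, with the quotient norm, onto the Banach space dual of $K\Lambda(\Omega)$. -/

import Mathlib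

open MeasureTheory
open scoped ENNReal InnerProductSpace

noncomputable section

namespace ELam

/-! ### Trace, trace class and Hilbert--Schmidt class of a complex Hilbert space -/

section Schatten

set_option linter.unusedSectionVars false

variable {H : Type*} [NormedAddCommGroup H] [InnerProductSpace ℂ H] [CompleteSpace H]

/-- The index set of a fixed orthonormal (Hilbert) basis of `H`. -/
def basisSet (H : Type*) [NormedAddCommGroup H] [InnerProductSpace ℂ H] [CompleteSpace H] :
    Set H :=
  (exists_hilbertBasis ℂ H).choose

/-- A fixed orthonormal (Hilbert) basis of `H`. -/
def basis (H : Type*) [NormedAddCommGroup H] [InnerProductSpace ℂ H] [CompleteSpace H] :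
    HilbertBasis (basisSet H) ℂ H :=
  (exists_hilbertBasis ℂ H).choose_spec.choose

/-- `Tr A = ∑ ⟪e_i, A e_i⟫ ∈ [0, ∞]` for a positive operator `A`. -/
def posTrace (A : H →L[ℂ] H) : ℝ≥0∞ :=
  ∑' i, ENNReal.ofReal (RCLike.re ⟪basis H i, A (basis H i)⟫_ℂ)

/-- The trace norm `|T|₁ = Tr (T⋆T)^(1/2)`, with value `∞` off the trace class. -/
def traceNorm (T : H →L[ℂ] H) : ℝ≥0∞ := posTrace (CFC.sqrt (star T * T))

/-- The Hilbert--Schmidt norm `|T|₂ = (Tr T⋆T)^(1/2)`, with value `∞` off the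
Hilbert--Schmidt class. -/
def hsNorm (T : H →L[ℂ] H) : ℝ≥0∞ := posTrace (star T * T) ^ (1 / 2 : ℝ)

/-- `T` belongs to the trace class. -/
def IsTraceClass (T : H →L[ℂ] H) : Prop := traceNorm T < ∞

/-- `T` belongs to the Hilbert--Schmidt class. -/
def IsHilbertSchmidt (T : H →L[ℂ] H) : Prop := hsNorm T < ∞

/-- The trace `Tr T = ∑ ⟪e_i, T e_i⟫` of a trace-class operator. -/
def trace (T : H →L[ℂ] H) : ℂ := ∑' i, ⟪basis H i, T (basis H i)⟫_ℂ

/-- The sum `∑ ‖T e_i‖²` along a Hilbert basis. -/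
def hsSum {ι : Type*} (b : HilbertBasis ι ℂ H) (T : H →L[ℂ] H) : ℝ≥0∞ :=
  ∑' i, ENNReal.ofReal (‖T (b i)‖ ^ 2)


theorem ofReal_norm_sq {ι : Type*} (b : HilbertBasis ι ℂ H) (x : H) :
    ENNReal.ofReal (‖x‖ ^ 2) = ∑' i, ENNReal.ofReal (‖⟪b i, x⟫_ℂ‖ ^ 2) := by
  have h := (b.hasSum_inner_mul_inner x x).mapL Complex.reCLM
  have h2 : HasSum (fun i => ‖⟪b i, x⟫_ℂ‖ ^ 2) (‖x‖ ^ 2) := by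
    convert h using 1
    · funext i
      rw [← inner_conj_symm x (b i), Complex.conj_mul']
      simp [← Complex.ofReal_pow]
    · rw [inner_self_eq_norm_sq_to_K]
      simp [← Complex.ofReal_pow]
  rw [← h2.tsum_eq, ENNReal.ofReal_tsum_of_nonneg (fun i => by positivity) h2.summable]

theorem hsSum_adjoint {ι κ : Type*} (b : HilbertBasis ι ℂ H) (c : HilbertBasis κ ℂ H)
    (T : H →L[ℂ] H) : hsSum b T = hsSum c (star T) := by
  unfold hsSum
  simp_rw [ofReal_norm_sq c (T _), ofReal_norm_sq b (star T _)]
  rw [ENNReal.tsum_comm]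
  refine tsum_congr fun j => tsum_congr fun i => ?_
  rw [ContinuousLinearMap.star_eq_adjoint, ContinuousLinearMap.adjoint_inner_right,
    ← inner_conj_symm, Complex.norm_conj]

theorem hsSum_indep {ι κ : Type*} (b : HilbertBasis ι ℂ H) (c : HilbertBasis κ ℂ H)
    (T : H →L[ℂ] H) : hsSum b T = hsSum c T := by
  rw [hsSum_adjoint b b, hsSum_adjoint b c, star_star]

theorem posTrace_star_mul_self {ι : Type*} (b : HilbertBasis ι ℂ H) (T : H →L[ℂ] H) :
    posTrace (star T * T) = hsSum b T := by
  rw [hsSum_indep b (basis H)]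
  refine tsum_congr fun i => ?_
  rw [mul_apply_eq_comp, ContinuousLinearMap.star_eq_adjoint,
    ContinuousLinearMap.adjoint_inner_right, inner_self_eq_norm_sq]

theorem hsNorm_eq {ι : Type*} (b : HilbertBasis ι ℂ H) (T : H →L[ℂ] H) :
    hsNorm T = hsSum b T ^ (1 / 2 : ℝ) := by
  rw [hsNorm, posTrace_star_mul_self b]

theorem posTrace_eq {ι : Type*} (b : HilbertBasis ι ℂ H) {A : H →L[ℂ] H} (hA : 0 ≤ A) :
    posTrace A = hsSum b (CFC.sqrt A) := by
  rw [← posTrace_star_mul_self b, (CFC.sqrt_nonneg A).isSelfAdjoint.star_eq,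
    CFC.sqrt_mul_sqrt_self A hA]

theorem hsSum_mul_le {ι : Type*} (b : HilbertBasis ι ℂ H) {V : H →L[ℂ] H} (hV : ‖V‖ ≤ 1)
    (T : H →L[ℂ] H) : hsSum b (V * T) ≤ hsSum b T := by
  refine ENNReal.tsum_le_tsum fun i => ENNReal.ofReal_le_ofReal ?_
  gcongr
  calc ‖V (T (b i))‖ ≤ ‖V‖ * ‖T (b i)‖ := V.le_opNorm _
    _ ≤ 1 * ‖T (b i)‖ := by gcongr
    _ = ‖T (b i)‖ := one_mul _

theorem eq_zero_of_hsSum {ι : Type*} (b : HilbertBasis ι ℂ H) {T : H →L[ℂ] H}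
    (h : hsSum b T = 0) : T = 0 := by
  have h0 : ∀ i, T (b i) = 0 := by
    intro i
    have := ENNReal.tsum_eq_zero.1 h i
    rw [ENNReal.ofReal_eq_zero] at this
    have h2 : ‖T (b i)‖ ^ 2 = 0 := le_antisymm this (by positivity)
    simpa using h2
  refine ContinuousLinearMap.ext_on (s := Set.range b) ?_ ?_
  · have := b.dense_span
    rw [Submodule.dense_iff_topologicalClosure_eq_top]
    exact this
  · rintro _ ⟨i, rfl⟩
    simpa using h0 i

theorem hsNorm_add_le (S T : H →L[ℂ] H) : hsNorm (S + T) ≤ hsNorm S + hsNorm T := by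
  have e : ∀ R : H →L[ℂ] H, hsNorm R = (∑' i, (‖R (basis H i)‖ₑ) ^ (2 : ℝ)) ^ (1 / 2 : ℝ) := by
    intro R
    rw [hsNorm_eq (basis H), hsSum]
    congr 1
    refine tsum_congr fun i => ?_
    rw [ENNReal.ofReal_pow (norm_nonneg _), ofReal_norm]
    norm_cast
  rw [e, e, e, one_div, ENNReal.rpow_inv_le_iff two_pos]
  rw [ENNReal.tsum_eq_iSup_sum]
  refine iSup_le fun s => ?_
  rw [← ENNReal.rpow_inv_le_iff two_pos, ← one_div]
  calc (∑ i ∈ s, ‖(S + T) (basis H i)‖ₑ ^ (2 : ℝ)) ^ (1 / 2 : ℝ)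
      ≤ (∑ i ∈ s, (‖S (basis H i)‖ₑ + ‖T (basis H i)‖ₑ) ^ (2 : ℝ)) ^ (1 / 2 : ℝ) := by
        gcongr with i _
        exact enorm_add_le _ _
    _ ≤ (∑ i ∈ s, ‖S (basis H i)‖ₑ ^ (2 : ℝ)) ^ (1 / 2 : ℝ)
        + (∑ i ∈ s, ‖T (basis H i)‖ₑ ^ (2 : ℝ)) ^ (1 / 2 : ℝ) :=
        ENNReal.Lp_add_le s _ _ one_le_two
    _ ≤ _ := by
        rw [one_div]
        gcongr <;> exact ENNReal.sum_le_tsum s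

theorem posTrace_smul {r : ℝ} (hr : 0 ≤ r) (A : H →L[ℂ] H) :
    posTrace (r • A) = ENNReal.ofReal r * posTrace A := by
  rw [posTrace, posTrace, ← ENNReal.tsum_mul_left]
  refine tsum_congr fun i => ?_
  rw [← ENNReal.ofReal_mul hr]
  congr 1
  rw [smul_apply, inner_smul_right_eq_smul]
  simp

theorem hsNorm_smul (c : ℂ) (T : H →L[ℂ] H) : hsNorm (c • T) = ‖c‖ₑ * hsNorm T := by
  have h : star (c • T) * (c • T) = (‖c‖ ^ 2 : ℝ) • (star T * T) := by
    rw [star_smul, smul_mul_smul_comm]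
    rw [show star c * c = ((‖c‖ ^ 2 : ℝ) : ℂ) by
      rw [Complex.star_def, Complex.conj_mul']; push_cast; rfl]
    exact Complex.coe_smul _ _
  rw [hsNorm, hsNorm, h, posTrace_smul (by positivity), ENNReal.mul_rpow_of_nonneg _ _ (by norm_num),
    ENNReal.ofReal_pow (norm_nonneg _), ofReal_norm, ← ENNReal.rpow_natCast, ← ENNReal.rpow_mul]
  norm_num

theorem norm_sqrt_apply (T : H →L[ℂ] H) (x : H) :
    ‖CFC.sqrt (star T * T) x‖ = ‖T x‖ := by
  have h1 : star (CFC.sqrt (star T * T)) * CFC.sqrt (star T * T) = star T * T := by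
    rw [(CFC.sqrt_nonneg _).isSelfAdjoint.star_eq,
      CFC.sqrt_mul_sqrt_self _ (star_mul_self_nonneg T)]
  have h2 : ∀ R : H →L[ℂ] H, ⟪x, (star R * R) x⟫_ℂ = ((‖R x‖ ^ 2 : ℝ) : ℂ) := by
    intro R
    rw [mul_apply_eq_comp, ContinuousLinearMap.star_eq_adjoint,
      ContinuousLinearMap.adjoint_inner_right, inner_self_eq_norm_sq_to_K]
    push_cast; rfl
  have h3 := h2 (CFC.sqrt (star T * T))
  rw [h1, h2 T, Complex.ofReal_inj] at h3
  exact ((sq_eq_sq₀ (norm_nonneg _) (norm_nonneg _)).1 h3).symm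

/-- A contraction `U` with `T = U |T|` and `|T| = U⋆ T`. -/
theorem exists_polar (T : H →L[ℂ] H) : ∃ U : H →L[ℂ] H, ‖U‖ ≤ 1 ∧
    T = U * CFC.sqrt (star T * T) ∧ CFC.sqrt (star T * T) = star U * T := by
  set A := CFC.sqrt (star T * T) with hA
  have hAT : ∀ x, ‖A x‖ = ‖T x‖ := norm_sqrt_apply T
  let K : Submodule ℂ H := (LinearMap.range A.toLinearMap).topologicalClosure
  have hmem : ∀ x, A x ∈ K := fun x =>
    Submodule.le_topologicalClosure _ (LinearMap.mem_range_self _ x)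
  let e : H →ₗ[ℂ] K := A.toLinearMap.codRestrict K hmem
  have : CompleteSpace K :=
    (Submodule.isClosed_topologicalClosure _).completeSpace_coe
  have hd : DenseRange e := by
    intro k
    rw [closure_subtype]
    have : (Subtype.val '' Set.range e) = (LinearMap.range A.toLinearMap : Set H) := by
      ext y
      simp [e]
    rw [this]
    exact k.2
  have hn : ∀ x, ‖T.toLinearMap x‖ ≤ 1 * ‖e x‖ := by
    intro x
    rw [one_mul]
    exact (hAT x).ge
  let W : K →L[ℂ] H := T.toLinearMap.extendOfNorm e
  have hW : ∀ x, W (e x) = T x := LinearMap.extendOfNorm_eq hd ⟨1, hn⟩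
  have hW1 : ∀ k, ‖W k‖ ≤ 1 * ‖k‖ := LinearMap.norm_extendOfNorm_apply_le hd 1 hn
  let U : H →L[ℂ] H := W ∘L K.orthogonalProjectionOnto
  have hU1 : ‖U‖ ≤ 1 := by
    refine ContinuousLinearMap.opNorm_le_bound _ zero_le_one fun x => ?_
    refine (hW1 _).trans ?_
    gcongr
    exact K.norm_orthogonalProjectionOnto_apply_le x
  have hUA : ∀ x, U (A x) = T x := by
    intro x
    have : K.orthogonalProjectionOnto (A x) = e x :=
      K.orthogonalProjectionOnto_mem_subspace_eq_self (e x)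
    exact (congrArg W this).trans (hW x)
  refine ⟨U, hU1, ?_, ?_⟩
  · ext x
    exact (hUA x).symm
  · ext x
    rw [mul_apply_eq_comp, ← hUA x]
    have hn2 : ‖star U (U (A x))‖ ≤ ‖A x‖ := by
      calc ‖star U (U (A x))‖ ≤ ‖star U‖ * ‖U (A x)‖ := (star U).le_opNorm _
        _ ≤ 1 * ‖U (A x)‖ := by rw [norm_star]; gcongr
        _ = ‖A x‖ := by rw [one_mul, hUA, hAT]
    have hin : RCLike.re ⟪A x, star U (U (A x))⟫_ℂ = ‖A x‖ ^ 2 := by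
      rw [ContinuousLinearMap.star_eq_adjoint, ContinuousLinearMap.adjoint_inner_right,
        inner_self_eq_norm_sq, hUA, hAT]
    have h := norm_sub_sq (𝕜 := ℂ) (A x) (star U (U (A x)))
    rw [hin] at h
    have h4 : ‖star U (U (A x))‖ ^ 2 ≤ ‖A x‖ ^ 2 := by gcongr
    have h5 : ‖A x - star U (U (A x))‖ ^ 2 = 0 :=
      le_antisymm (by linarith) (by positivity)
    exact sub_eq_zero.1 (norm_eq_zero.1 (pow_eq_zero_iff two_ne_zero |>.1 h5))

theorem tsum_inner_le_traceNorm {V : H →L[ℂ] H} (hV : ‖V‖ ≤ 1) (T : H →L[ℂ] H) :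
    ∑' i, ‖⟪basis H i, V (T (basis H i))⟫_ℂ‖ₑ ≤ traceNorm T := by
  obtain ⟨U, hU, hT, -⟩ := exists_polar T
  have hA : 0 ≤ CFC.sqrt (star T * T) := CFC.sqrt_nonneg _
  set A := CFC.sqrt (star T * T) with hAdef
  set R := CFC.sqrt A with hR
  have hRR : R * R = A := CFC.sqrt_mul_sqrt_self A hA
  have hVU : ‖V * U‖ ≤ 1 := (norm_mul_le _ _).trans (mul_le_one₀ hV (norm_nonneg _) hU)
  have key : ∀ i, ‖⟪basis H i, V (T (basis H i))⟫_ℂ‖ₑ ≤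
      2⁻¹ * (ENNReal.ofReal (‖star (V * U * R) (basis H i)‖ ^ 2)
        + ENNReal.ofReal (‖R (basis H i)‖ ^ 2)) := by
    intro i
    have h1 : V (T (basis H i)) = (V * U * R) (R (basis H i)) := by
      conv_lhs => rw [hT, ← hRR]
      rfl
    have h2 : ‖⟪basis H i, V (T (basis H i))⟫_ℂ‖ ≤
        ‖star (V * U * R) (basis H i)‖ * ‖R (basis H i)‖ := by
      rw [h1, ← ContinuousLinearMap.adjoint_inner_left, ContinuousLinearMap.star_eq_adjoint]
      exact norm_inner_le_norm _ _
    rw [← ENNReal.ofReal_add (by positivity) (by positivity), ← ofReal_norm,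
      show (2⁻¹ : ℝ≥0∞) = ENNReal.ofReal 2⁻¹ by
        rw [ENNReal.ofReal_inv_of_pos two_pos]; simp,
      ← ENNReal.ofReal_mul (by norm_num)]
    refine ENNReal.ofReal_le_ofReal (h2.trans ?_)
    nlinarith [sq_nonneg (‖star (V * U * R) (basis H i)‖ - ‖R (basis H i)‖)]
  calc ∑' i, ‖⟪basis H i, V (T (basis H i))⟫_ℂ‖ₑ
      ≤ 2⁻¹ * (hsSum (basis H) (star (V * U * R)) + hsSum (basis H) R) := by
        rw [hsSum, hsSum, ← ENNReal.tsum_add, ← ENNReal.tsum_mul_left]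
        exact ENNReal.tsum_le_tsum key
    _ ≤ 2⁻¹ * (hsSum (basis H) R + hsSum (basis H) R) := by
        gcongr
        rw [← hsSum_adjoint (basis H)]
        exact hsSum_mul_le _ hVU R
    _ = hsSum (basis H) R := by
        rw [← two_mul, ← mul_assoc, ENNReal.inv_mul_cancel two_ne_zero ENNReal.ofNat_ne_top, one_mul]
    _ = traceNorm T := by
        rw [traceNorm, posTrace_eq (basis H) hA]

theorem traceNorm_add_le (S T : H →L[ℂ] H) :
    traceNorm (S + T) ≤ traceNorm S + traceNorm T := by
  obtain ⟨U, hU, -, hA⟩ := exists_polar (S + T)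
  have hU' : ‖star U‖ ≤ 1 := by rwa [norm_star]
  refine le_trans ?_ (add_le_add (tsum_inner_le_traceNorm hU' S) (tsum_inner_le_traceNorm hU' T))
  rw [← ENNReal.tsum_add, traceNorm, posTrace, hA]
  refine ENNReal.tsum_le_tsum fun i => ?_
  rw [mul_apply_eq_comp, add_apply, map_add, inner_add_right]
  refine le_trans ?_ (enorm_add_le _ _)
  rw [← ofReal_norm]
  exact ENNReal.ofReal_le_ofReal (RCLike.re_le_norm _)

theorem traceNorm_smul (c : ℂ) (T : H →L[ℂ] H) : traceNorm (c • T) = ‖c‖ₑ * traceNorm T := by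
  have h : CFC.sqrt (star (c • T) * (c • T)) = ‖c‖ • CFC.sqrt (star T * T) := CFC.abs_smul c T
  rw [traceNorm, h, posTrace_smul (norm_nonneg c), ofReal_norm, traceNorm]

theorem eq_zero_of_traceNorm {T : H →L[ℂ] H} (h : traceNorm T = 0) : T = 0 := by
  rw [traceNorm, posTrace_eq (basis H) (CFC.sqrt_nonneg _)] at h
  have h1 := eq_zero_of_hsSum _ h
  have h2 : CFC.sqrt (star T * T) = 0 := by
    rw [← CFC.sqrt_mul_sqrt_self (CFC.sqrt (star T * T)) (CFC.sqrt_nonneg _), h1, mul_zero]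
  obtain ⟨U, -, hT, -⟩ := exists_polar T
  rw [hT, h2, mul_zero]

theorem eq_zero_of_hsNorm {T : H →L[ℂ] H} (h : hsNorm T = 0) : T = 0 := by
  rw [hsNorm_eq (basis H), ENNReal.rpow_eq_zero_iff_of_pos (by norm_num)] at h
  exact eq_zero_of_hsSum _ h

variable (H) in
/-- The space `C₁(H)` of trace-class operators, as a subspace of `B(H)`. -/
def traceClassSubmodule : Submodule ℂ (H →L[ℂ] H) where
  carrier := {T | IsTraceClass T}
  add_mem' {S T} hS hT := (traceNorm_add_le S T).trans_lt (ENNReal.add_lt_top.2 ⟨hS, hT⟩)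
  zero_mem' := by
    have h := traceNorm_smul (0 : ℂ) (0 : H →L[ℂ] H)
    simp only [zero_smul, enorm_zero, zero_mul] at h
    simp [IsTraceClass, h]
  smul_mem' c T hT := by
    change traceNorm (c • T) < ∞
    rw [traceNorm_smul]
    exact ENNReal.mul_lt_top enorm_lt_top hT

variable (H) in
/-- The space `C₂(H)` of Hilbert--Schmidt operators, as a subspace of `B(H)`. -/
def hilbertSchmidtSubmodule : Submodule ℂ (H →L[ℂ] H) where
  carrier := {T | IsHilbertSchmidt T}
  add_mem' {S T} hS hT := (hsNorm_add_le S T).trans_lt (ENNReal.add_lt_top.2 ⟨hS, hT⟩)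
  zero_mem' := by
    have h := hsNorm_smul (0 : ℂ) (0 : H →L[ℂ] H)
    simp only [zero_smul, enorm_zero, zero_mul] at h
    simp [IsHilbertSchmidt, h]
  smul_mem' c T hT := by
    change hsNorm (c • T) < ∞
    rw [hsNorm_smul]
    exact ENNReal.mul_lt_top enorm_lt_top hT

variable (H) in
/-- `C₁(H)` as a normed space with the trace norm (a type synonym, so that it does not carry the
operator norm). -/
def TraceClass : Type _ := traceClassSubmodule H

variable (H) in
/-- `C₂(H)` as a normed space with the Hilbert--Schmidt norm (a type synonym, so that it does not
carry the operator norm). -/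
def HilbertSchmidt : Type _ := hilbertSchmidtSubmodule H

instance : AddCommGroup (TraceClass H) := inferInstanceAs (AddCommGroup (traceClassSubmodule H))
instance : Module ℂ (TraceClass H) := inferInstanceAs (Module ℂ (traceClassSubmodule H))
instance : AddCommGroup (HilbertSchmidt H) :=
  inferInstanceAs (AddCommGroup (hilbertSchmidtSubmodule H))
instance : Module ℂ (HilbertSchmidt H) := inferInstanceAs (Module ℂ (hilbertSchmidtSubmodule H))

/-- The operator underlying an element of `C₁(H)`. -/
def TraceClass.toOp : TraceClass H →ₗ[ℂ] (H →L[ℂ] H) := (traceClassSubmodule H).subtype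

/-- The operator underlying an element of `C₂(H)`. -/
def HilbertSchmidt.toOp : HilbertSchmidt H →ₗ[ℂ] (H →L[ℂ] H) := (hilbertSchmidtSubmodule H).subtype

theorem TraceClass.toOp_injective : Function.Injective (TraceClass.toOp (H := H)) :=
  Subtype.val_injective

theorem HilbertSchmidt.toOp_injective : Function.Injective (HilbertSchmidt.toOp (H := H)) :=
  Subtype.val_injective

theorem TraceClass.isTraceClass (x : TraceClass H) : IsTraceClass x.toOp := x.2

theorem HilbertSchmidt.isHilbertSchmidt (x : HilbertSchmidt H) : IsHilbertSchmidt x.toOp := x.2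

instance : Norm (TraceClass H) := ⟨fun x => (traceNorm x.toOp).toReal⟩
instance : Norm (HilbertSchmidt H) := ⟨fun x => (hsNorm x.toOp).toReal⟩

theorem TraceClass.norm_def (x : TraceClass H) : ‖x‖ = (traceNorm x.toOp).toReal := rfl

theorem HilbertSchmidt.norm_def (x : HilbertSchmidt H) : ‖x‖ = (hsNorm x.toOp).toReal := rfl

theorem TraceClass.core : NormedSpace.Core ℂ (TraceClass H) where
  norm_nonneg _ := ENNReal.toReal_nonneg
  norm_smul c x := by
    rw [norm_def, norm_def, map_smul, traceNorm_smul, ENNReal.toReal_mul, toReal_enorm]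
  norm_triangle x y := by
    rw [norm_def, norm_def, norm_def, map_add,
      ← ENNReal.toReal_add x.isTraceClass.ne y.isTraceClass.ne]
    exact ENNReal.toReal_mono (ENNReal.add_lt_top.2 ⟨x.isTraceClass, y.isTraceClass⟩).ne
      (traceNorm_add_le _ _)
  norm_eq_zero_iff x := by
    refine ⟨fun h => ?_, fun h => ?_⟩
    · rw [norm_def, ENNReal.toReal_eq_zero_iff] at h
      exact toOp_injective ((eq_zero_of_traceNorm (h.resolve_right x.isTraceClass.ne)).trans
        (map_zero _).symm)
    · have h2 := traceNorm_smul (0 : ℂ) (x.toOp)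
      rw [norm_def, h, map_zero]
      simp only [zero_smul, enorm_zero, zero_mul] at h2
      rw [h2, ENNReal.toReal_zero]

theorem HilbertSchmidt.core : NormedSpace.Core ℂ (HilbertSchmidt H) where
  norm_nonneg _ := ENNReal.toReal_nonneg
  norm_smul c x := by
    rw [norm_def, norm_def, map_smul, hsNorm_smul, ENNReal.toReal_mul, toReal_enorm]
  norm_triangle x y := by
    rw [norm_def, norm_def, norm_def, map_add,
      ← ENNReal.toReal_add x.isHilbertSchmidt.ne y.isHilbertSchmidt.ne]
    exact ENNReal.toReal_mono (ENNReal.add_lt_top.2 ⟨x.isHilbertSchmidt, y.isHilbertSchmidt⟩).ne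
      (hsNorm_add_le _ _)
  norm_eq_zero_iff x := by
    refine ⟨fun h => ?_, fun h => ?_⟩
    · rw [norm_def, ENNReal.toReal_eq_zero_iff] at h
      exact toOp_injective ((eq_zero_of_hsNorm (h.resolve_right x.isHilbertSchmidt.ne)).trans
        (map_zero _).symm)
    · have h2 := hsNorm_smul (0 : ℂ) (x.toOp)
      rw [norm_def, h, map_zero]
      simp only [zero_smul, enorm_zero, zero_mul] at h2
      rw [h2, ENNReal.toReal_zero]

instance : NormedAddCommGroup (TraceClass H) := NormedAddCommGroup.ofCore TraceClass.core
instance : NormedSpace ℂ (TraceClass H) := NormedSpace.ofCore TraceClass.core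
instance : NormedAddCommGroup (HilbertSchmidt H) := NormedAddCommGroup.ofCore HilbertSchmidt.core
instance : NormedSpace ℂ (HilbertSchmidt H) := NormedSpace.ofCore HilbertSchmidt.core

end Schatten

/-! ### The algebra `EΛ(Ω)` and its ideal `KΛ(Ω)` of compact operators -/

section Lip

/-- Lebesgue measure on `Ω ⊆ ℂ`. -/
abbrev leb (Ω : Set ℂ) : Measure ℂ := volume.restrict Ω

/-- The Hilbert space `L²(Ω, λ)`. -/
abbrev L2 (Ω : Set ℂ) : Type := Lp ℂ 2 (leb Ω)

/-- The bounded operators on `L²(Ω, λ)`. -/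
abbrev Op (Ω : Set ℂ) : Type := L2 Ω →L[ℂ] L2 Ω

/-- The commutator `[A, B] = AB - BA`. -/
def comm {Ω : Set ℂ} (A B : Op Ω) : Op Ω := A * B - B * A

theorem comm_add {Ω : Set ℂ} (A B C : Op Ω) : comm A (B + C) = comm A B + comm A C := by
  simp only [comm, mul_add, add_mul]; abel

theorem comm_smul {Ω : Set ℂ} (c : ℂ) (A B : Op Ω) : comm A (c • B) = c • comm A B := by
  simp only [comm, mul_smul_comm, smul_mul_assoc, smul_sub]

theorem comm_zero {Ω : Set ℂ} (A : Op Ω) : comm A 0 = 0 := by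
  simp [comm]

/-- The operator `M_f` of multiplication by `f ∈ L^∞(Ω, λ)` on `L²(Ω, λ)`. -/
def mulOp {Ω : Set ℂ} (f : Lp ℂ ∞ (leb Ω)) : Op Ω :=
  (ContinuousLinearMap.mul ℂ ℂ).holderL (leb Ω) ∞ 2 2 f

/-- The difference quotient `Df(s, t) = (f(s) - f(t)) / (s - t)`; the diagonal, where it is `0`,
is a null set. -/
def diffQuot (f : ℂ → ℂ) (p : ℂ × ℂ) : ℂ := (f p.1 - f p.2) / (p.1 - p.2)

/-- The set `Λ(Ω)` of essentially Lipschitz functions `f ∈ L^∞(Ω, λ)`. -/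
def Lam (Ω : Set ℂ) : Set (Lp ℂ ∞ (leb Ω)) :=
  {f | MemLp (diffQuot f) ∞ ((leb Ω).prod (leb Ω))}

/-- `L(T) = sup {|[M_f, T]|₂ : f ∈ Λ(Ω), ‖Df‖_∞ ≤ 1} ∈ [0, ∞]`. -/
def lipNorm {Ω : Set ℂ} (T : Op Ω) : ℝ≥0∞ :=
  ⨆ f ∈ {f : Lp ℂ ∞ (leb Ω) |
    f ∈ Lam Ω ∧ eLpNorm (diffQuot f) ∞ ((leb Ω).prod (leb Ω)) ≤ 1},
    hsNorm (comm (mulOp f) T)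

theorem lipNorm_add_le {Ω : Set ℂ} (S T : Op Ω) : lipNorm (S + T) ≤ lipNorm S + lipNorm T := by
  refine iSup₂_le fun f hf => ?_
  rw [comm_add]
  exact (hsNorm_add_le _ _).trans (add_le_add
    (le_iSup₂ (f := fun g _ => hsNorm (comm (mulOp g) S)) f hf)
    (le_iSup₂ (f := fun g _ => hsNorm (comm (mulOp g) T)) f hf))

theorem lipNorm_smul {Ω : Set ℂ} (c : ℂ) (T : Op Ω) : lipNorm (c • T) = ‖c‖ₑ * lipNorm T := by
  simp only [lipNorm, ENNReal.mul_iSup, ← hsNorm_smul]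
  simp only [comm_smul]

/-- `EΛ(Ω) = {T ∈ B(L²(Ω, λ)) : L(T) < ∞}`, as a linear space. -/
def ELambda (Ω : Set ℂ) : Submodule ℂ (Op Ω) where
  carrier := {T | lipNorm T < ∞}
  add_mem' {S T} hS hT := (lipNorm_add_le S T).trans_lt (ENNReal.add_lt_top.2 ⟨hS, hT⟩)
  zero_mem' := by
    have h := lipNorm_smul (0 : ℂ) (0 : Op Ω)
    simp only [zero_smul, enorm_zero, zero_mul] at h
    simp [h]
  smul_mem' c T hT := by
    change lipNorm (c • T) < ∞
    rw [lipNorm_smul]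
    exact ENNReal.mul_lt_top enorm_lt_top hT

/-- `KΛ(Ω)`, the compact operators in `EΛ(Ω)`, as a subspace of `B(L²(Ω, λ))`. -/
def kLambdaSubmodule (Ω : Set ℂ) : Submodule ℂ (Op Ω) :=
  ELambda Ω ⊓ compactOperator (RingHom.id ℂ) (L2 Ω) (L2 Ω)

/-- `KΛ(Ω)` as a normed space with the norm `‖T‖ + L(T)` (a type synonym, so that it does not
carry the operator norm). -/
def KLambda (Ω : Set ℂ) : Type := kLambdaSubmodule Ω

variable {Ω : Set ℂ}

instance : AddCommGroup (KLambda Ω) := inferInstanceAs (AddCommGroup (kLambdaSubmodule Ω))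
instance : Module ℂ (KLambda Ω) := inferInstanceAs (Module ℂ (kLambdaSubmodule Ω))

/-- The operator underlying an element of `KΛ(Ω)`. -/
def KLambda.toOp : KLambda Ω →ₗ[ℂ] Op Ω := (kLambdaSubmodule Ω).subtype

theorem KLambda.toOp_injective : Function.Injective (KLambda.toOp (Ω := Ω)) :=
  Subtype.val_injective

theorem KLambda.lipNorm_lt_top (T : KLambda Ω) : lipNorm T.toOp < ∞ := T.2.1

theorem KLambda.isCompactOperator (T : KLambda Ω) : IsCompactOperator T.toOp := T.2.2

instance : Norm (KLambda Ω) := ⟨fun T => ‖T.toOp‖ + (lipNorm T.toOp).toReal⟩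

theorem KLambda.norm_def (T : KLambda Ω) : ‖T‖ = ‖T.toOp‖ + (lipNorm T.toOp).toReal := rfl

theorem KLambda.core : NormedSpace.Core ℂ (KLambda Ω) where
  norm_nonneg _ := add_nonneg (norm_nonneg _) ENNReal.toReal_nonneg
  norm_smul c T := by
    rw [norm_def, norm_def, map_smul, lipNorm_smul, ENNReal.toReal_mul, toReal_enorm, norm_smul,
      mul_add]
  norm_triangle S T := by
    have h : (lipNorm (S.toOp + T.toOp)).toReal
        ≤ (lipNorm S.toOp).toReal + (lipNorm T.toOp).toReal := by
      rw [← ENNReal.toReal_add S.lipNorm_lt_top.ne T.lipNorm_lt_top.ne]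
      exact ENNReal.toReal_mono (ENNReal.add_lt_top.2 ⟨S.lipNorm_lt_top, T.lipNorm_lt_top⟩).ne
        (lipNorm_add_le _ _)
    rw [norm_def, norm_def, norm_def, map_add]
    linarith [norm_add_le S.toOp T.toOp]
  norm_eq_zero_iff T := by
    refine ⟨fun h => ?_, fun h => ?_⟩
    · rw [norm_def] at h
      have h0 : ‖T.toOp‖ = 0 := le_antisymm
        (by linarith [ENNReal.toReal_nonneg (a := lipNorm T.toOp)]) (norm_nonneg _)
      exact toOp_injective ((norm_eq_zero.1 h0).trans (map_zero _).symm)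
    · have h2 := lipNorm_smul (0 : ℂ) (T.toOp)
      rw [norm_def, h, map_zero]
      simp only [zero_smul, enorm_zero, zero_mul] at h2
      rw [h2, ENNReal.toReal_zero, norm_zero, add_zero]

instance : NormedAddCommGroup (KLambda Ω) := NormedAddCommGroup.ofCore KLambda.core
instance : NormedSpace ℂ (KLambda Ω) := NormedSpace.ofCore KLambda.core

theorem memLp_id (hm : MeasurableSet Ω) (hb : Bornology.IsBounded Ω) :
    MemLp (fun z : ℂ => z) ∞ (leb Ω) := by
  obtain ⟨C, hC⟩ := hb.exists_norm_le
  exact memLp_top_of_bound measurable_id.aestronglyMeasurable C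
    (ae_restrict_of_forall_mem hm hC)

/-- The operator `Z` of multiplication by the coordinate `z` on `L²(Ω, λ)`, for bounded `Ω`. -/
def opZ (hm : MeasurableSet Ω) (hb : Bornology.IsBounded Ω) : Op Ω :=
  mulOp ((memLp_id hm hb).toLp (fun z : ℂ => z))

/-- `N = {([Z, h], h) : h ∈ C₂, [Z, h] ∈ C₁} ⊆ C₁ × C₂`. -/
def annN (hm : MeasurableSet Ω) (hb : Bornology.IsBounded Ω) :
    Submodule ℂ (TraceClass (L2 Ω) × HilbertSchmidt (L2 Ω)) where
  carrier := {p | p.1.toOp = comm (opZ hm hb) p.2.toOp}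
  add_mem' {p q} hp hq := by
    change (p.1 + q.1).toOp = comm (opZ hm hb) (p.2 + q.2).toOp
    rw [map_add, map_add, comm_add, hp, hq]
  zero_mem' := by
    change (0 : TraceClass (L2 Ω)).toOp = comm (opZ hm hb) (0 : HilbertSchmidt (L2 Ω)).toOp
    rw [map_zero, map_zero, comm_zero]
  smul_mem' c p hp := by
    change (c • p.1).toOp = comm (opZ hm hb) (c • p.2).toOp
    rw [map_smul, map_smul, comm_smul, hp]

end Lip

end ELam

end

namespace ELam

open Filter Topology InnerProductSpace

/-! ### Estimates for the Schatten norms, and finite-rank approximation. -/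

section Operators

set_option linter.unusedSectionVars false

variable {H : Type*} [NormedAddCommGroup H] [InnerProductSpace ℂ H] [CompleteSpace H]

/-! ### Hilbert--Schmidt norm estimates -/

/-! The whole theorem rests on one estimate specific to dimension two. Cut the plane into squares of
side `1/(n+1)` and let `u_k` be the normalized indicators of the squares that meet `Ω` in positive
measure. If `f` is 1-Lipschitz and `z_k` is a sample point in the `k`-th square, then `M_f u_k -
f(z_k) u_k` has norm at most `2/(n+1)`. Since there are `O((n+1)^2)` squares, the squared errors
have a sum bounded independently of `n`. The errors for different squares have disjoint supports,
hence are orthogonal and tend to zero weakly in the square-summable sense. `AlmostDiag` records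
these two facts.

For compact `T` the errors `T w_k` and `T* w'_k` therefore vanish in `ℓ²`, and the matrix of `[M_f,
T]` is asymptotically `(f(z_k) - f(z_l)) T_kl`. Because `|f(z_k) - f(z_l)| ≤ |z_k - z_l|`, the
supremum defining `L(T)` is attained at the coordinate function: `L(T) = |[Z, T]|₂` (`lipNorm_eq`).

The uniform bound on the errors also gives `|Tr [Z, X]| ≤ C |X|₂` whenever `X` is Hilbert--Schmidt
and `[Z, X]` is of trace class. Finite-rank operators have commutators of trace zero and are dense
in `C₂`, so `Tr [Z, X] = 0` (`trace_comm_opZ_eq_zero`).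

Now `T ↦ (T, [Z, T])` is an isometry of `KΛ(Ω)` into the `ℓ¹` sum of `B(L²)` and `C₂`. A functional
extends by Hahn--Banach to a pair of functionals, each of norm at most the original; on compact
operators the first is given by some `x ∈ C₁`, the second by some `y ∈ C₂` (`exists_pairing_eq`).
This gives surjectivity and a representative with no loss of norm. The kernel of the pairing lies in
`N`, as is seen by testing on rank-one operators. Conversely, for `x = [Z, H]` and `y = H`, one has
`Tx + [Z, T]y = [Z, TH]`, whose trace vanishes (`pairing_eq_zero_iff`). -/

theorem hsNorm_sq (T : H →L[ℂ] H) : hsNorm T ^ 2 = hsSum (basis H) T := by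
  rw [hsNorm_eq (basis H), ← ENNReal.rpow_natCast, ← ENNReal.rpow_mul]
  norm_num

theorem hsNorm_le_iff {T : H →L[ℂ] H} {c : ℝ≥0∞} : hsNorm T ≤ c ↔ hsSum (basis H) T ≤ c ^ 2 := by
  rw [← hsNorm_sq]
  exact (ENNReal.pow_le_pow_left_iff two_ne_zero).symm

theorem hsNorm_star (T : H →L[ℂ] H) : hsNorm (star T) = hsNorm T := by
  rw [hsNorm_eq (basis H), hsNorm_eq (basis H), hsSum_adjoint (basis H) (basis H) T]

theorem hsNorm_mul_le (A B : H →L[ℂ] H) : hsNorm (A * B) ≤ ‖A‖ₑ * hsNorm B := by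
  rw [hsNorm_le_iff, mul_pow, hsNorm_sq, hsSum, hsSum, ← ENNReal.tsum_mul_left]
  refine ENNReal.tsum_le_tsum fun i => ?_
  rw [ENNReal.ofReal_pow (norm_nonneg _), ENNReal.ofReal_pow (norm_nonneg _), ofReal_norm,
    ofReal_norm, ← mul_pow]
  gcongr
  exact A.le_opENorm _

theorem hsNorm_mul_le' (A B : H →L[ℂ] H) : hsNorm (A * B) ≤ hsNorm A * ‖B‖ₑ := by
  rw [← hsNorm_star, star_mul, mul_comm (hsNorm A), ← hsNorm_star A]
  refine (hsNorm_mul_le _ _).trans_eq ?_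
  congr 1
  rw [← ofReal_norm, ← ofReal_norm, norm_star]

theorem hsNorm_neg (T : H →L[ℂ] H) : hsNorm (-T) = hsNorm T := by
  rw [← neg_one_smul ℂ T, hsNorm_smul]
  simp

theorem hsNorm_sub_le (S T : H →L[ℂ] H) : hsNorm (S - T) ≤ hsNorm S + hsNorm T := by
  rw [sub_eq_add_neg, ← hsNorm_neg T]
  exact hsNorm_add_le _ _

theorem IsHilbertSchmidt.mul_left {B : H →L[ℂ] H} (hB : IsHilbertSchmidt B) (A : H →L[ℂ] H) :
    IsHilbertSchmidt (A * B) :=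
  (hsNorm_mul_le A B).trans_lt (ENNReal.mul_lt_top enorm_lt_top hB)

theorem IsHilbertSchmidt.mul_right {A : H →L[ℂ] H} (hA : IsHilbertSchmidt A) (B : H →L[ℂ] H) :
    IsHilbertSchmidt (A * B) :=
  (hsNorm_mul_le' A B).trans_lt (ENNReal.mul_lt_top hA enorm_lt_top)

theorem IsHilbertSchmidt.star {A : H →L[ℂ] H} (hA : IsHilbertSchmidt A) :
    IsHilbertSchmidt (star A) := by
  rwa [IsHilbertSchmidt, hsNorm_star]

theorem IsHilbertSchmidt.sub {A B : H →L[ℂ] H} (hA : IsHilbertSchmidt A)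
    (hB : IsHilbertSchmidt B) : IsHilbertSchmidt (A - B) :=
  (hsNorm_sub_le A B).trans_lt (ENNReal.add_lt_top.2 ⟨hA, hB⟩)

theorem IsHilbertSchmidt.hsSum_lt_top {B : H →L[ℂ] H} (hB : IsHilbertSchmidt B) :
    hsSum (basis H) B < ∞ := by
  rw [← hsNorm_sq]
  exact ENNReal.pow_lt_top hB

theorem IsHilbertSchmidt.summable {B : H →L[ℂ] H} (hB : IsHilbertSchmidt B) :
    Summable fun i => ‖B (basis H i)‖ ^ 2 := by
  have h := ENNReal.summable_toReal hB.hsSum_lt_top.ne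
  refine h.congr fun i => ?_
  exact ENNReal.toReal_ofReal (by positivity)

/-- Left multiplication by a bounded family converging strongly to zero converges to zero in
Hilbert--Schmidt norm. -/
theorem tendsto_hsNorm_mul {α : Type*} {l : Filter α} {D : α → H →L[ℂ] H} {c : ℝ}
    (hc : ∀ n, ‖D n‖ ≤ c) (hD : ∀ x, Tendsto (fun n => D n x) l (𝓝 0))
    {B : H →L[ℂ] H} (hB : IsHilbertSchmidt B) :
    Tendsto (fun n => hsNorm (D n * B)) l (𝓝 0) := by
  have hle : ∀ n i, ‖(D n * B) (basis H i)‖ ^ 2 ≤ c ^ 2 * ‖B (basis H i)‖ ^ 2 := by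
    intro n i
    rw [← mul_pow]
    gcongr
    exact (D n).le_of_opNorm_le (hc n) _
  have h1 : Tendsto (fun n => ∑' i, ‖(D n * B) (basis H i)‖ ^ 2) l (𝓝 (∑' _ : basisSet H, (0 : ℝ))) := by
    refine tendsto_tsum_of_dominated_convergence (hB.summable.mul_left (c ^ 2)) (fun i => ?_)
      (Eventually.of_forall fun n i => ?_)
    · simpa using ((hD (B (basis H i))).norm.pow 2)
    · rw [Real.norm_of_nonneg (by positivity)]
      exact hle n i
  rw [tsum_zero] at h1
  have h2 : Tendsto (fun n => hsSum (basis H) (D n * B)) l (𝓝 0) := by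
    have h3 := ENNReal.tendsto_ofReal h1
    rw [ENNReal.ofReal_zero] at h3
    refine h3.congr fun n => ?_
    exact ENNReal.ofReal_tsum_of_nonneg (fun i => by positivity)
      (Summable.of_nonneg_of_le (fun i => by positivity) (hle n) (hB.summable.mul_left _))
  have h3 := h2.ennrpow_const (1 / 2 : ℝ)
  rw [ENNReal.zero_rpow_of_pos (by norm_num)] at h3
  exact h3.congr fun n => (hsNorm_eq (basis H) _).symm

/-! ### Trace norm estimates -/

/-- The contraction `U*` from the polar decomposition recovers `|T| = U* T`, so `V = U*` already
yields the trace norm. This reduces ideal inequalities for the trace norm to diagonal sums in the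
fixed basis. -/
theorem traceNorm_le_of_forall {T : H →L[ℂ] H} {C : ℝ≥0∞}
    (h : ∀ V : H →L[ℂ] H, ‖V‖ ≤ 1 → ∑' i, ‖⟪basis H i, V (T (basis H i))⟫_ℂ‖ₑ ≤ C) :
    traceNorm T ≤ C := by
  obtain ⟨U, hU, -, hA⟩ := exists_polar T
  refine le_trans ?_ (h (star U) (by rwa [norm_star]))
  rw [traceNorm, posTrace, hA]
  refine ENNReal.tsum_le_tsum fun i => ?_
  rw [mul_apply_eq_comp, ← ofReal_norm]
  exact ENNReal.ofReal_le_ofReal (RCLike.re_le_norm _)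

theorem tsum_inner_le_norm_mul_traceNorm (A T : H →L[ℂ] H) :
    ∑' i, ‖⟪basis H i, A (T (basis H i))⟫_ℂ‖ₑ ≤ ‖A‖ₑ * traceNorm T := by
  rcases eq_or_ne A 0 with rfl | hA
  · simp
  have hA' : (‖A‖ : ℂ) ≠ 0 := by simpa using hA
  have hV : ‖((‖A‖ : ℂ)⁻¹) • A‖ ≤ 1 := by
    rw [norm_smul, norm_inv, Complex.norm_real, norm_norm, inv_mul_cancel₀ (by simpa using hA)]
  refine le_trans (le_of_eq ?_) (mul_le_mul_right (tsum_inner_le_traceNorm hV T) _)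
  rw [← ENNReal.tsum_mul_left]
  refine tsum_congr fun i => ?_
  rw [smul_apply, inner_smul_right, enorm_mul, ← mul_assoc]
  have : ‖A‖ₑ * ‖(‖A‖ : ℂ)⁻¹‖ₑ = 1 := by
    have h2 : ‖A‖ₑ = ‖(‖A‖ : ℂ)‖ₑ := by
      rw [← ofReal_norm, ← ofReal_norm]; simp
    rw [h2, ← enorm_mul, mul_inv_cancel₀ hA', enorm_one]
  rw [this, one_mul]

theorem traceNorm_mul_le (A T : H →L[ℂ] H) : traceNorm (A * T) ≤ ‖A‖ₑ * traceNorm T := by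
  refine traceNorm_le_of_forall fun V hV => ?_
  refine (tsum_inner_le_norm_mul_traceNorm (V * A) T).trans ?_
  gcongr
  rw [← ofReal_norm, ← ofReal_norm]
  exact ENNReal.ofReal_le_ofReal ((norm_mul_le _ _).trans
    (mul_le_of_le_one_left (norm_nonneg _) hV))

/-- Cauchy--Schwarz twice: in `H` for each index, then in `ℓ²` on finite partial sums. -/
theorem tsum_inner_le_hsNorm_mul (A B : H →L[ℂ] H) :
    ∑' i, ‖⟪A (basis H i), B (basis H i)⟫_ℂ‖ₑ ≤ hsNorm A * hsNorm B := by
  have e : ∀ R : H →L[ℂ] H, hsNorm R = (∑' i, (‖R (basis H i)‖ₑ) ^ (2 : ℝ)) ^ (1 / 2 : ℝ) := by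
    intro R
    rw [hsNorm_eq (basis H), hsSum]
    congr 1
    refine tsum_congr fun i => ?_
    rw [ENNReal.ofReal_pow (norm_nonneg _), ofReal_norm]
    norm_cast
  rw [e, e, ENNReal.tsum_eq_iSup_sum]
  refine iSup_le fun s => ?_
  calc ∑ i ∈ s, ‖⟪A (basis H i), B (basis H i)⟫_ℂ‖ₑ
      ≤ ∑ i ∈ s, ‖A (basis H i)‖ₑ * ‖B (basis H i)‖ₑ := by
        refine Finset.sum_le_sum fun i _ => ?_
        rw [← ofReal_norm, ← ofReal_norm, ← ofReal_norm, ← ENNReal.ofReal_mul (norm_nonneg _)]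
        exact ENNReal.ofReal_le_ofReal (norm_inner_le_norm _ _)
    _ ≤ (∑ i ∈ s, ‖A (basis H i)‖ₑ ^ (2 : ℝ)) ^ (1 / 2 : ℝ)
        * (∑ i ∈ s, ‖B (basis H i)‖ₑ ^ (2 : ℝ)) ^ (1 / 2 : ℝ) :=
        ENNReal.inner_le_Lp_mul_Lq s _ _ Real.HolderConjugate.two_two
    _ ≤ _ := by
        gcongr <;> exact ENNReal.sum_le_tsum s

/-- Move `V A` to the other side of the inner product as its adjoint, which has the same
Hilbert--Schmidt norm; the contraction `V` costs nothing. -/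
theorem traceNorm_mul_le_hsNorm_mul (A B : H →L[ℂ] H) :
    traceNorm (A * B) ≤ hsNorm A * hsNorm B := by
  refine traceNorm_le_of_forall fun V hV => ?_
  have h := tsum_inner_le_hsNorm_mul (star (V * A)) B
  rw [hsNorm_star] at h
  refine le_trans (le_of_eq ?_) (h.trans (mul_le_mul_left ?_ _))
  · refine tsum_congr fun i => ?_
    rw [ContinuousLinearMap.star_eq_adjoint, ContinuousLinearMap.adjoint_inner_left]
    rfl
  · refine (hsNorm_mul_le V A).trans (mul_le_of_le_one_left zero_le ?_)
    rw [← ofReal_norm]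
    exact ENNReal.ofReal_le_one.2 hV

theorem IsHilbertSchmidt.isTraceClass_mul {A B : H →L[ℂ] H} (hA : IsHilbertSchmidt A)
    (hB : IsHilbertSchmidt B) : IsTraceClass (A * B) :=
  (traceNorm_mul_le_hsNorm_mul A B).trans_lt (ENNReal.mul_lt_top hA hB)

theorem IsTraceClass.mul_left {T : H →L[ℂ] H} (hT : IsTraceClass T) (A : H →L[ℂ] H) :
    IsTraceClass (A * T) :=
  (traceNorm_mul_le A T).trans_lt (ENNReal.mul_lt_top enorm_lt_top hT)

theorem IsTraceClass.add {S T : H →L[ℂ] H} (hS : IsTraceClass S) (hT : IsTraceClass T) :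
    IsTraceClass (S + T) :=
  (traceNorm_add_le S T).trans_lt (ENNReal.add_lt_top.2 ⟨hS, hT⟩)

theorem IsTraceClass.sub {S T : H →L[ℂ] H} (hS : IsTraceClass S) (hT : IsTraceClass T) :
    IsTraceClass (S - T) :=
  (traceClassSubmodule H).sub_mem hS hT

/-- A trace-class operator is a product of two Hilbert--Schmidt operators. -/
theorem IsTraceClass.exists_mul {T : H →L[ℂ] H} (hT : IsTraceClass T) :
    ∃ A B : H →L[ℂ] H, IsHilbertSchmidt A ∧ IsHilbertSchmidt B ∧ T = A * B := by
  obtain ⟨U, -, hU, -⟩ := exists_polar T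
  have hA : 0 ≤ CFC.sqrt (star T * T) := CFC.sqrt_nonneg _
  have hR : IsHilbertSchmidt (CFC.sqrt (CFC.sqrt (star T * T))) := by
    rw [IsHilbertSchmidt, hsNorm_eq (basis H), ← posTrace_eq (basis H) hA]
    exact ENNReal.rpow_lt_top_of_nonneg (by norm_num) hT.ne
  -- The factorization is `T = (U |T|^(1/2)) |T|^(1/2)`, where `|T|^(1/2)` is Hilbert--Schmidt
  -- because its squared norm is `Tr |T|`.
  refine ⟨_, _, hR.mul_left U, hR, ?_⟩
  rw [mul_assoc, CFC.sqrt_mul_sqrt_self _ hA, ← hU]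

/-! ### The trace -/

theorem IsTraceClass.summable_norm {T : H →L[ℂ] H} (hT : IsTraceClass T) :
    Summable fun i => ‖⟪basis H i, T (basis H i)⟫_ℂ‖ := by
  have h := tsum_inner_le_norm_mul_traceNorm (1 : H →L[ℂ] H) T
  have h2 := ENNReal.summable_toReal (h.trans_lt (ENNReal.mul_lt_top enorm_lt_top hT)).ne
  simpa using h2

theorem IsTraceClass.hasSum_trace {T : H →L[ℂ] H} (hT : IsTraceClass T) :
    HasSum (fun i => ⟪basis H i, T (basis H i)⟫_ℂ) (trace T) :=
  hT.summable_norm.of_norm.hasSum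

theorem enorm_trace_le (T : H →L[ℂ] H) : ‖trace T‖ₑ ≤ traceNorm T := by
  by_cases hT : IsTraceClass T
  · have h := tsum_inner_le_traceNorm (V := (1 : H →L[ℂ] H)) ContinuousLinearMap.norm_id_le T
    exact enorm_tsum_le_tsum_enorm.trans h
  · have : traceNorm T = ∞ := by simpa [IsTraceClass] using hT
    simp [this]

theorem IsTraceClass.trace_add {S T : H →L[ℂ] H} (hS : IsTraceClass S) (hT : IsTraceClass T) :
    trace (S + T) = trace S + trace T := by
  change ∑' i, ⟪basis H i, (S + T) (basis H i)⟫_ℂ = _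
  refine HasSum.tsum_eq ?_
  simpa [inner_add_right] using hS.hasSum_trace.add hT.hasSum_trace

theorem IsTraceClass.trace_sub {S T : H →L[ℂ] H} (hS : IsTraceClass S) (hT : IsTraceClass T) :
    trace (S - T) = trace S - trace T := by
  change ∑' i, ⟪basis H i, (S - T) (basis H i)⟫_ℂ = _
  refine HasSum.tsum_eq ?_
  simpa [inner_sub_right] using hS.hasSum_trace.sub hT.hasSum_trace

theorem trace_smul (c : ℂ) (T : H →L[ℂ] H) : trace (c • T) = c * trace T := by
  simp only [trace, smul_apply, inner_smul_right, tsum_mul_left]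

/-- Parseval's identity for `T* b` and `a`; boundedness of `T` is enough for convergence. -/
theorem hasSum_trace_rankOne_mul (a b : H) (T : H →L[ℂ] H) :
    HasSum (fun i => ⟪basis H i, (rankOne ℂ a b * T) (basis H i)⟫_ℂ) ⟪b, T a⟫_ℂ := by
  have h := (basis H).hasSum_inner_mul_inner (star T b) a
  rw [ContinuousLinearMap.star_eq_adjoint, ContinuousLinearMap.adjoint_inner_left] at h
  refine h.congr_fun fun i => ?_
  rw [ContinuousLinearMap.adjoint_inner_left, mul_apply_eq_comp, rankOne_apply, inner_smul_right]

theorem trace_sum_rankOne_mul {ι : Type*} (s : Finset ι) (a b : ι → H) (T : H →L[ℂ] H) :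
    trace ((∑ i ∈ s, rankOne ℂ (a i) (b i)) * T) = ∑ i ∈ s, ⟪b i, T (a i)⟫_ℂ := by
  rw [trace]
  refine HasSum.tsum_eq ?_
  refine (hasSum_sum fun i (_ : i ∈ s) => hasSum_trace_rankOne_mul (a i) (b i) T).congr_fun
    fun j => ?_
  rw [Finset.sum_mul, sum_apply, inner_sum]

theorem hsSum_rankOne (a b : H) :
    hsSum (basis H) (rankOne ℂ a b) = ENNReal.ofReal ((‖a‖ * ‖b‖) ^ 2) := by
  rw [mul_pow, mul_comm, ENNReal.ofReal_mul (by positivity), ofReal_norm_sq (basis H) b,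
    ← ENNReal.tsum_mul_right]
  refine tsum_congr fun i => ?_
  rw [← ENNReal.ofReal_mul (by positivity), rankOne_apply, norm_smul, mul_pow, norm_inner_symm]

theorem hsNorm_rankOne (a b : H) : hsNorm (rankOne ℂ a b) = ENNReal.ofReal (‖a‖ * ‖b‖) := by
  rw [hsNorm_eq (basis H), hsSum_rankOne, ENNReal.ofReal_pow (by positivity),
    ← ENNReal.rpow_natCast, ← ENNReal.rpow_mul]
  norm_num

theorem isHilbertSchmidt_rankOne (a b : H) : IsHilbertSchmidt (rankOne ℂ a b) := by
  rw [IsHilbertSchmidt, hsNorm_rankOne]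
  exact ENNReal.ofReal_lt_top

theorem mul_rankOne (A : H →L[ℂ] H) (a b : H) : A * rankOne ℂ a b = rankOne ℂ (A a) b := by
  ext x
  simp [mul_apply_eq_comp]

theorem rankOne_mul (A : H →L[ℂ] H) (a b : H) :
    rankOne ℂ a b * A = rankOne ℂ a (star A b) := by
  ext x
  simp [mul_apply_eq_comp, ContinuousLinearMap.star_eq_adjoint,
    ContinuousLinearMap.adjoint_inner_left]

theorem star_rankOne (a b : H) : star (rankOne ℂ a b) = rankOne ℂ b a := by
  rw [ContinuousLinearMap.star_eq_adjoint, adjoint_rankOne]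

/-- Up to the scalar `⟨b, b⟩⁻¹`, the operator `|a⟩⟨b|` is the product of the Hilbert--Schmidt
operators `|a⟩⟨b|` and `|b⟩⟨b|`. -/
theorem isTraceClass_rankOne (a b : H) : IsTraceClass (rankOne ℂ a b) := by
  rcases eq_or_ne b 0 with rfl | hb
  · rw [map_zero]
    exact (traceClassSubmodule H).zero_mem
  · have hb' : (⟪b, b⟫_ℂ) ≠ 0 := inner_self_ne_zero.2 hb
    have h := (isHilbertSchmidt_rankOne (((⟪b, b⟫_ℂ)⁻¹) • a) b).isTraceClass_mul
      (isHilbertSchmidt_rankOne b b)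
    rwa [mul_rankOne, rankOne_apply, smul_smul, mul_inv_cancel₀ hb', one_smul] at h

/-! ### Finite-rank projections -/

/-- The finite-rank operator `∑ |u_i⟩⟨u_i|`. -/
noncomputable def frameProj {ι : Type*} (s : Finset ι) (u : ι → H) : H →L[ℂ] H :=
  ∑ i ∈ s, rankOne ℂ (u i) (u i)

theorem frameProj_apply {ι : Type*} (s : Finset ι) (u : ι → H) (x : H) :
    frameProj s u x = ∑ i ∈ s, ⟪u i, x⟫_ℂ • u i := by
  simp [frameProj, sum_apply]

theorem star_frameProj {ι : Type*} (s : Finset ι) (u : ι → H) :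
    star (frameProj s u) = frameProj s u := by
  simp [frameProj, star_sum, star_rankOne]

theorem norm_sum_smul_sq {ι : Type*} {u : ι → H} (hu : Orthonormal ℂ u) (s : Finset ι)
    (c : ι → ℂ) : ‖∑ i ∈ s, c i • u i‖ ^ 2 = ∑ i ∈ s, ‖c i‖ ^ 2 := by
  have h := hu.inner_sum c c s
  rw [inner_self_eq_norm_sq_to_K] at h
  simp_rw [Complex.conj_mul'] at h
  apply Complex.ofReal_injective
  push_cast
  exact h

theorem norm_frameProj_apply_sq {ι : Type*} {u : ι → H} (hu : Orthonormal ℂ u) (s : Finset ι)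
    (x : H) : ‖frameProj s u x‖ ^ 2 = ∑ i ∈ s, ‖⟪u i, x⟫_ℂ‖ ^ 2 := by
  rw [frameProj_apply, norm_sum_smul_sq hu]

theorem norm_frameProj_le {ι : Type*} {u : ι → H} (hu : Orthonormal ℂ u) (s : Finset ι) :
    ‖frameProj s u‖ ≤ 1 := by
  refine ContinuousLinearMap.opNorm_le_bound _ zero_le_one fun x => ?_
  rw [one_mul, ← sq_le_sq₀ (norm_nonneg _) (norm_nonneg _), norm_frameProj_apply_sq hu]
  exact hu.sum_inner_products_le x

theorem frameProj_mul {ι : Type*} (s : Finset ι) (u : ι → H) (T : H →L[ℂ] H) :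
    frameProj s u * T = ∑ i ∈ s, rankOne ℂ (u i) (star T (u i)) := by
  simp [frameProj, Finset.sum_mul, rankOne_mul]

theorem tendsto_frameProj_basis (x : H) :
    Tendsto (fun s => frameProj s (basis H) x) atTop (𝓝 x) := by
  have h := (basis H).hasSum_repr x
  refine h.congr fun s => ?_
  simp [frameProj_apply, HilbertBasis.repr_apply_apply]

theorem norm_one_sub_frameProj_le {ι : Type*} {u : ι → H} (hu : Orthonormal ℂ u)
    (s : Finset ι) : ‖1 - frameProj s u‖ ≤ 2 := by
  have h1 : ‖(1 : H →L[ℂ] H)‖ ≤ 1 := ContinuousLinearMap.norm_id_le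
  linarith [norm_sub_le (1 : H →L[ℂ] H) (frameProj s u), norm_frameProj_le hu s]

/-- The filter and the index types are left free so that this serves both the grid projections,
indexed by `n`, and the partial sums of the fixed basis, indexed by finite sets. -/
theorem tendsto_hsNorm_sub_frameProj_mul {α : Type*} {l : Filter α} {ι : α → Type*}
    {s : ∀ n, Finset (ι n)} {u : ∀ n, ι n → H} (hu : ∀ n, Orthonormal ℂ (u n))
    (hlim : ∀ x, Tendsto (fun n => frameProj (s n) (u n) x) l (𝓝 x))
    {B : H →L[ℂ] H} (hB : IsHilbertSchmidt B) :
    Tendsto (fun n => hsNorm (B - frameProj (s n) (u n) * B)) l (𝓝 0) := by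
  have h := tendsto_hsNorm_mul (D := fun n => 1 - frameProj (s n) (u n)) (c := 2) (l := l)
    (fun n => norm_one_sub_frameProj_le (hu n) _) (fun x => ?_) hB
  · simpa only [sub_mul, one_mul] using h
  · have := (tendsto_const_nhds (x := x)).sub (hlim x)
    simpa using this

/-- Uniformly bounded operators that converge strongly converge uniformly on compact sets: take a
finite `ε/3`-net of the closed image of the unit ball and project far enough to fix its points up to
`ε/3`. -/
theorem IsCompactOperator.exists_norm_sub_frameProj_mul_le {T : H →L[ℂ] H}
    (hT : IsCompactOperator T) {ε : ℝ} (hε : 0 < ε) :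
    ∃ s : Finset (basisSet H), ‖T - frameProj s (basis H) * T‖ ≤ ε := by
  have hK : IsCompact (closure (T '' Metric.closedBall 0 1)) :=
    hT.isCompact_closure_image_closedBall (𝕜₁ := ℂ) 1
  obtain ⟨t, -, htf, hcov⟩ := hK.finite_cover_balls (e := ε / 3) (by positivity)
  have hev : ∀ᶠ s in atTop, ∀ y ∈ t, ‖y - frameProj s (basis H) y‖ < ε / 3 := by
    rw [Filter.eventually_all_finite htf]
    intro y _
    have := (tendsto_const_nhds (x := y)).sub (tendsto_frameProj_basis y)
    rw [sub_self] at this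
    have h2 := this.norm
    rw [norm_zero] at h2
    exact h2.eventually_lt_const (by positivity)
  obtain ⟨s, hs⟩ := hev.exists
  refine ⟨s, ContinuousLinearMap.opNorm_le_of_unit_norm hε.le fun x hx => ?_⟩
  have hx' : T x ∈ closure (T '' Metric.closedBall 0 1) :=
    subset_closure ⟨x, by simp [hx], rfl⟩
  obtain ⟨y, hy, hxy⟩ := Set.mem_iUnion₂.1 (hcov hx')
  rw [Metric.mem_ball, dist_eq_norm] at hxy
  have e : (T - frameProj s (basis H) * T) x =
      (T x - y) + (y - frameProj s (basis H) y) - frameProj s (basis H) (T x - y) := by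
    rw [sub_apply, mul_apply_eq_comp, map_sub]; abel
  rw [e]
  have h1 : ‖frameProj s (basis H) (T x - y)‖ ≤ 1 * ‖T x - y‖ :=
    ContinuousLinearMap.le_of_opNorm_le _ (norm_frameProj_le (basis H).orthonormal s) _
  linarith [norm_sub_le ((T x - y) + (y - frameProj s (basis H) y))
    (frameProj s (basis H) (T x - y)), norm_add_le (T x - y) (y - frameProj s (basis H) y), hs y hy]

end Operators

/-! ### Commutators with operators that are asymptotically diagonal. -/

section Frames

set_option linter.unusedSectionVars false

variable {H : Type*} [NormedAddCommGroup H] [InnerProductSpace ℂ H] [CompleteSpace H]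

/-! ### Finite orthonormal families -/

/-- Expand in the fixed basis, pass to `K*` and apply Bessel's inequality to each `K* e_i`.
Extending the family to a full orthonormal basis is thereby avoided. -/
theorem ofReal_sum_norm_apply_sq_le {ι : Type*} {u : ι → H} (hu : Orthonormal ℂ u)
    (s : Finset ι) (K : H →L[ℂ] H) :
    ENNReal.ofReal (∑ l ∈ s, ‖K (u l)‖ ^ 2) ≤ hsSum (basis H) K := by
  rw [hsSum_adjoint (basis H) (basis H), ENNReal.ofReal_sum_of_nonneg fun i _ => by positivity]
  simp_rw [ofReal_norm_sq (basis H) (K _)]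
  rw [← Summable.tsum_finsetSum fun _ _ => ENNReal.summable]
  refine ENNReal.tsum_le_tsum fun i => ?_
  rw [← ENNReal.ofReal_sum_of_nonneg fun i _ => by positivity]
  refine ENNReal.ofReal_le_ofReal (le_trans (le_of_eq ?_) (hu.sum_inner_products_le _ (s := s)))
  refine Finset.sum_congr rfl fun l _ => ?_
  rw [ContinuousLinearMap.star_eq_adjoint, ContinuousLinearMap.adjoint_inner_right,
    norm_inner_symm]

theorem IsHilbertSchmidt.sum_norm_apply_sq_le {ι : Type*} {u : ι → H} (hu : Orthonormal ℂ u)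
    (s : Finset ι) {K : H →L[ℂ] H} (hK : IsHilbertSchmidt K) :
    ∑ l ∈ s, ‖K (u l)‖ ^ 2 ≤ (hsNorm K).toReal ^ 2 := by
  have h := ofReal_sum_norm_apply_sq_le hu s K
  rw [← hsNorm_sq] at h
  rw [← ENNReal.toReal_pow]
  exact (ENNReal.ofReal_le_iff_le_toReal (ENNReal.pow_lt_top hK).ne).1 h

theorem IsHilbertSchmidt.sum_sum_inner_sq_le {ι : Type*} {u : ι → H} (hu : Orthonormal ℂ u)
    (s : Finset ι) {K : H →L[ℂ] H} (hK : IsHilbertSchmidt K) :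
    ∑ k ∈ s, ∑ l ∈ s, ‖⟪u k, K (u l)⟫_ℂ‖ ^ 2 ≤ (hsNorm K).toReal ^ 2 := by
  rw [Finset.sum_comm]
  exact (Finset.sum_le_sum fun l _ => hu.sum_inner_products_le _).trans
    (hK.sum_norm_apply_sq_le hu s)

/-- With `P` the projection onto the `u`'s, `⟨u_k, K P e_i⟩ = ⟨P K* u_k, e_i⟩`. Bessel's inequality
in `i` leaves `‖P K* u_k‖²`, which is the `k`-th row sum of the matrix of `K`. -/
theorem sum_norm_compression_sq_le {ι κ : Type*} {u : ι → H} {e : κ → H} (hu : Orthonormal ℂ u)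
    (he : Orthonormal ℂ e) (s : Finset ι) (t : Finset κ) (K : H →L[ℂ] H) :
    ∑ i ∈ t, ‖frameProj s u (K (frameProj s u (e i)))‖ ^ 2
      ≤ ∑ k ∈ s, ∑ l ∈ s, ‖⟪u k, K (u l)⟫_ℂ‖ ^ 2 := by
  simp_rw [norm_frameProj_apply_sq hu]
  rw [Finset.sum_comm]
  refine Finset.sum_le_sum fun k _ => ?_
  have h1 : ∀ x, ⟪u k, K (frameProj s u x)⟫_ℂ = ⟪frameProj s u (star K (u k)), x⟫_ℂ := by
    intro x
    conv_rhs => rw [← star_frameProj]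
    rw [ContinuousLinearMap.star_eq_adjoint, ContinuousLinearMap.star_eq_adjoint,
      ContinuousLinearMap.adjoint_inner_left, ContinuousLinearMap.adjoint_inner_left]
  have h2 : ∀ l, ‖⟪u k, K (u l)⟫_ℂ‖ = ‖⟪u l, star K (u k)⟫_ℂ‖ := by
    intro l
    rw [ContinuousLinearMap.star_eq_adjoint, ContinuousLinearMap.adjoint_inner_right,
      norm_inner_symm]
  simp_rw [h1, h2, ← norm_frameProj_apply_sq hu, norm_inner_symm _ (e _)]
  exact he.sum_inner_products_le _

theorem tendsto_frameProj_apply {ι : ℕ → Type*} {s : ∀ n, Finset (ι n)} {u : ∀ n, ι n → H}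
    (hu : ∀ n, Orthonormal ℂ (u n))
    (hlim : ∀ x, Tendsto (fun n => frameProj (s n) (u n) x) atTop (𝓝 x)) {y : ℕ → H} {z : H}
    (hy : Tendsto y atTop (𝓝 z)) :
    Tendsto (fun n => frameProj (s n) (u n) (y n)) atTop (𝓝 z) := by
  have h0 : Tendsto (fun n => frameProj (s n) (u n) (y n - z)) atTop (𝓝 0) := by
    refine squeeze_zero_norm (a := fun n => ‖y n - z‖) (fun n => ?_) ?_
    · simpa using ContinuousLinearMap.le_of_opNorm_le _ (norm_frameProj_le (hu n) (s n)) (y n - z)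
    · simpa using (hy.sub_const z).norm
  have h := h0.add (hlim z)
  rw [zero_add] at h
  refine h.congr fun n => ?_
  rw [← map_add, sub_add_cancel]

/-- Lower semicontinuity of the Hilbert--Schmidt norm under compressions. -/
theorem hsNorm_le_of_compressions {ι : ℕ → Type*} {s : ∀ n, Finset (ι n)} {u : ∀ n, ι n → H}
    (hu : ∀ n, Orthonormal ℂ (u n))
    (hlim : ∀ x, Tendsto (fun n => frameProj (s n) (u n) x) atTop (𝓝 x)) {K : H →L[ℂ] H}
    {r : ℕ → ℝ} {c : ℝ} (hr : Tendsto r atTop (𝓝 c)) (hc : 0 ≤ c)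
    (hK : ∀ n, ∑ k ∈ s n, ∑ l ∈ s n, ‖⟪u n k, K (u n l)⟫_ℂ‖ ^ 2 ≤ r n ^ 2) :
    hsNorm K ≤ ENNReal.ofReal c := by
  rw [hsNorm_le_iff, ← ENNReal.ofReal_pow hc, hsSum, ENNReal.tsum_eq_iSup_sum]
  refine iSup_le fun t => ?_
  rw [← ENNReal.ofReal_sum_of_nonneg fun i _ => by positivity]
  refine ENNReal.ofReal_le_ofReal ?_
  -- Only finitely many basis vectors occur in `t`, so the strong convergence `P K P → K` suffices.
  refine le_of_tendsto_of_tendsto (tendsto_finsetSum t fun i _ => ?_) (hr.pow 2)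
    (Eventually.of_forall fun n =>
      (sum_norm_compression_sq_le (hu n) (basis H).orthonormal (s n) t K).trans (hK n))
  exact (tendsto_frameProj_apply hu hlim ((K.continuous.tendsto _).comp (hlim _))).norm.pow 2

/-- Write `Y = AB` with Hilbert--Schmidt factors; then `|Y - PY|₁ ≤ |A - PA|₂ |B|₂`, and the first
factor tends to zero. -/
theorem tendsto_trace_frameProj_mul {ι : ℕ → Type*} {s : ∀ n, Finset (ι n)} {u : ∀ n, ι n → H}
    (hu : ∀ n, Orthonormal ℂ (u n))
    (hlim : ∀ x, Tendsto (fun n => frameProj (s n) (u n) x) atTop (𝓝 x)) {Y : H →L[ℂ] H}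
    (hY : IsTraceClass Y) :
    Tendsto (fun n => trace (frameProj (s n) (u n) * Y)) atTop (𝓝 (trace Y)) := by
  obtain ⟨A, B, hA, hB, hAB⟩ := hY.exists_mul
  have h1 := ENNReal.Tendsto.mul_const (tendsto_hsNorm_sub_frameProj_mul hu hlim hA)
    (Or.inr hB.ne) (b := hsNorm B)
  rw [zero_mul] at h1
  rw [tendsto_iff_edist_tendsto_0]
  refine tendsto_of_tendsto_of_tendsto_of_le_of_le tendsto_const_nhds h1 (fun _ => zero_le)
    fun n => ?_
  rw [edist_comm, edist_eq_enorm_sub, ← hY.trace_sub (hY.mul_left _)]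
  refine (enorm_trace_le _).trans (le_trans (le_of_eq ?_) (traceNorm_mul_le_hsNorm_mul _ _))
  rw [sub_mul, hAB, mul_assoc]

/-! ### Operators that are almost diagonal along a sequence of orthonormal families -/

/-- The vectors `u n k` are approximate eigenvectors of `M` with eigenvalues `a n k`: the errors
are square-summable uniformly in `n`, and weakly small. -/
structure AlmostDiag (M : H →L[ℂ] H) {ι : ℕ → Type*} (s : ∀ n, Finset (ι n)) (u : ∀ n, ι n → H)
    (a : ∀ n, ι n → ℂ) : Prop where
  bounded : ∃ C, ∀ n, ∑ k ∈ s n, ‖M (u n k) - a n k • u n k‖ ^ 2 ≤ C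
  weak : ∀ ξ, Tendsto (fun n => ∑ k ∈ s n, ‖⟪ξ, M (u n k) - a n k • u n k⟫_ℂ‖ ^ 2) atTop (𝓝 0)

/-- `T` is a norm limit of operators of finite rank. -/
def IsApproximable (T : H →L[ℂ] H) : Prop :=
  ∀ ε > 0, ∃ (t : Finset (basisSet H)) (a b : basisSet H → H),
    ‖T - ∑ i ∈ t, rankOne ℂ (a i) (b i)‖ ≤ ε

theorem IsCompactOperator.isApproximable {T : H →L[ℂ] H} (hT : IsCompactOperator T) :
    IsApproximable T := by
  intro ε hε
  obtain ⟨t, ht⟩ := IsCompactOperator.exists_norm_sub_frameProj_mul_le hT hε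
  rw [frameProj_mul] at ht
  exact ⟨t, _, _, ht⟩

/-- The commutator estimate applies `T*` to the errors of `M*`. Stating it for norm limits of
finite-rank operators makes passage to the adjoint a mere swap of vectors, in place of Schauder's
theorem. -/
theorem IsApproximable.star {T : H →L[ℂ] H} (hT : IsApproximable T) :
    IsApproximable (star T) := by
  intro ε hε
  obtain ⟨t, a, b, h⟩ := hT ε hε
  refine ⟨t, b, a, ?_⟩
  rw [← norm_star, star_sub, star_sum, star_star]
  simpa only [star_rankOne] using h

/-- For a finite-rank operator this is the weak smallness of the errors. The remainder of norm at
most `ε` contributes at most a multiple of `ε² C` by the uniform bound. -/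
theorem AlmostDiag.tendsto_sum_norm_apply_sq {M : H →L[ℂ] H} {ι : ℕ → Type*}
    {s : ∀ n, Finset (ι n)} {u : ∀ n, ι n → H} {a : ∀ n, ι n → ℂ} (h : AlmostDiag M s u a)
    {T : H →L[ℂ] H} (hT : IsApproximable T) :
    Tendsto (fun n => ∑ k ∈ s n, ‖T (M (u n k) - a n k • u n k)‖ ^ 2) atTop (𝓝 0) := by
  set w : ∀ n, ι n → H := fun n k => M (u n k) - a n k • u n k with hw
  obtain ⟨C, hC⟩ := h.bounded
  have hC0 : 0 ≤ C := le_trans (by positivity) (hC 0)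
  have fin : ∀ (t : Finset (basisSet H)) (p q : basisSet H → H),
      Tendsto (fun n => ∑ k ∈ s n, ‖(∑ i ∈ t, rankOne ℂ (p i) (q i)) (w n k)‖ ^ 2)
        atTop (𝓝 0) := by
    intro t p q
    have h1 : Tendsto (fun n => (t.card : ℝ) * ∑ i ∈ t, ‖p i‖ ^ 2 *
        ∑ k ∈ s n, ‖⟪q i, w n k⟫_ℂ‖ ^ 2) atTop (𝓝 0) := by
      have := (tendsto_finsetSum t fun i _ => (h.weak (q i)).const_mul (‖p i‖ ^ 2)).const_mul
        (t.card : ℝ)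
      simpa only [mul_zero, Finset.sum_const_zero] using this
    refine squeeze_zero (fun n => by positivity) (fun n => ?_) h1
    simp_rw [Finset.mul_sum]
    rw [Finset.sum_comm]
    refine Finset.sum_le_sum fun k _ => ?_
    rw [← Finset.mul_sum, sum_apply]
    have h2 : ‖∑ i ∈ t, rankOne ℂ (p i) (q i) (w n k)‖ ≤
        ∑ i ∈ t, ‖p i‖ * ‖⟪q i, w n k⟫_ℂ‖ := by
      refine (norm_sum_le _ _).trans_eq (Finset.sum_congr rfl fun i _ => ?_)
      rw [rankOne_apply, norm_smul, mul_comm]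
    calc _ ≤ (∑ i ∈ t, ‖p i‖ * ‖⟪q i, w n k⟫_ℂ‖) ^ 2 := by gcongr
      _ ≤ t.card * ∑ i ∈ t, (‖p i‖ * ‖⟪q i, w n k⟫_ℂ‖) ^ 2 := sq_sum_le_card_mul_sum_sq
      _ = _ := by simp_rw [mul_pow]
  rw [Metric.tendsto_atTop]
  intro η hη
  obtain ⟨ε, hε, hεη⟩ : ∃ ε > 0, 2 * (ε ^ 2 * C) ≤ η / 2 := by
    -- With `C + 1` the denominator is positive even when `C = 0`; the remainder then uses at most
    -- half of `η`.
    refine ⟨√(η / (4 * (C + 1))), by positivity, ?_⟩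
    rw [Real.sq_sqrt (by positivity), div_mul_eq_mul_div, ← mul_div_assoc,
      div_le_div_iff₀ (by positivity) (by positivity)]
    nlinarith
  obtain ⟨t, p, q, hS⟩ := hT ε hε
  set S := ∑ i ∈ t, rankOne ℂ (p i) (q i) with hSdef
  obtain ⟨n₀, hn₀⟩ := Metric.tendsto_atTop.1 (fin t p q) (η / 4) (by positivity)
  refine ⟨n₀, fun n hn => ?_⟩
  have h3 := hn₀ n hn
  rw [Real.dist_0_eq_abs, abs_of_nonneg (by positivity)] at h3 ⊢
  have h4 : ∀ k, ‖T (w n k)‖ ^ 2 ≤ 2 * (ε ^ 2 * ‖w n k‖ ^ 2) + 2 * ‖S (w n k)‖ ^ 2 := by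
    intro k
    have h5 : ‖T (w n k)‖ ≤ ε * ‖w n k‖ + ‖S (w n k)‖ := by
      have h6 : ‖(T - S) (w n k)‖ ≤ ε * ‖w n k‖ := ContinuousLinearMap.le_of_opNorm_le _ hS _
      have h7 : T (w n k) = (T - S) (w n k) + S (w n k) := by simp
      rw [h7]
      exact (norm_add_le _ _).trans (by gcongr)
    calc ‖T (w n k)‖ ^ 2 ≤ (ε * ‖w n k‖ + ‖S (w n k)‖) ^ 2 := by gcongr
      _ ≤ _ := by nlinarith [sq_nonneg (ε * ‖w n k‖ - ‖S (w n k)‖)]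
  calc ∑ k ∈ s n, ‖T (w n k)‖ ^ 2
      ≤ ∑ k ∈ s n, (2 * (ε ^ 2 * ‖w n k‖ ^ 2) + 2 * ‖S (w n k)‖ ^ 2) :=
        Finset.sum_le_sum fun k _ => h4 k
    _ = 2 * (ε ^ 2 * ∑ k ∈ s n, ‖w n k‖ ^ 2) + 2 * ∑ k ∈ s n, ‖S (w n k)‖ ^ 2 := by
        rw [Finset.sum_add_distrib, ← Finset.mul_sum, ← Finset.mul_sum, ← Finset.mul_sum]
    _ ≤ 2 * (ε ^ 2 * C) + 2 * ∑ k ∈ s n, ‖S (w n k)‖ ^ 2 := by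
        gcongr
        exact hC n
    _ < η := by linarith

/-- The `ℓ²` norm of a finite matrix. -/
noncomputable def matNorm {ι : Type*} (s : Finset ι) (X : ι → ι → ℂ) : ℝ :=
  √(∑ k ∈ s, ∑ l ∈ s, ‖X k l‖ ^ 2)

theorem matNorm_sq {ι : Type*} (s : Finset ι) (X : ι → ι → ℂ) :
    matNorm s X ^ 2 = ∑ k ∈ s, ∑ l ∈ s, ‖X k l‖ ^ 2 :=
  Real.sq_sqrt (by positivity)

theorem matNorm_mono {ι : Type*} (s : Finset ι) {X Y : ι → ι → ℂ}
    (h : ∀ k l, ‖X k l‖ ≤ ‖Y k l‖) : matNorm s X ≤ matNorm s Y := by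
  refine Real.sqrt_le_sqrt (Finset.sum_le_sum fun k _ => Finset.sum_le_sum fun l _ => ?_)
  gcongr
  exact h k l

theorem matNorm_add_le {ι : Type*} (s : Finset ι) (X Y : ι → ι → ℂ) :
    matNorm s (fun k l => X k l + Y k l) ≤ matNorm s X + matNorm s Y := by
  have e : ∀ Z : ι → ι → ℂ, matNorm s Z =
      ‖(WithLp.toLp 2 (fun p : s × s => Z p.1 p.2) : EuclideanSpace ℂ (s × s))‖ := by
    -- The matrix norm is the Euclidean norm on `s × s`, from which the triangle inequality is
    -- taken.
    intro Z
    rw [EuclideanSpace.norm_eq, matNorm, Fintype.sum_prod_type, ← Finset.sum_coe_sort]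
    simp_rw [← Finset.sum_coe_sort s fun l => ‖Z _ l‖ ^ 2]
  rw [e, e, e]
  exact norm_add_le (WithLp.toLp 2 (fun p : s × s => X p.1 p.2) : EuclideanSpace ℂ (s × s))
    (WithLp.toLp 2 (fun p : s × s => Y p.1 p.2))

theorem matNorm_neg {ι : Type*} (s : Finset ι) (X : ι → ι → ℂ) :
    matNorm s (fun k l => -X k l) = matNorm s X := by
  simp [matNorm]

/-- The `ℓ²` error made by replacing `[M, T]` with its diagonal approximation tends to zero. -/
theorem AlmostDiag.exists_matNorm_commutator_le {M : H →L[ℂ] H} {ι : ℕ → Type*}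
    {s : ∀ n, Finset (ι n)} {u : ∀ n, ι n → H} {a : ∀ n, ι n → ℂ}
    (hu : ∀ n, Orthonormal ℂ (u n)) (h : AlmostDiag M s u a)
    (h' : AlmostDiag (star M) s u (fun n k => star (a n k))) {T : H →L[ℂ] H}
    (hT : IsApproximable T) :
    ∃ e : ℕ → ℝ, Tendsto e atTop (𝓝 0) ∧ ∀ n,
      matNorm (s n) (fun k l => ⟪u n k, (M * T - T * M) (u n l)⟫_ℂ
        - (a n k - a n l) * ⟪u n k, T (u n l)⟫_ℂ) ≤ e n := by
  have h1 := (h.tendsto_sum_norm_apply_sq hT).sqrt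
  have h2 := (h'.tendsto_sum_norm_apply_sq hT.star).sqrt
  rw [Real.sqrt_zero] at h1 h2
  have h12 := h2.add h1
  rw [add_zero] at h12
  refine ⟨_, h12, fun n => ?_⟩
  set w : ι n → H := fun k => M (u n k) - a n k • u n k with hw
  set w' : ι n → H := fun k => star M (u n k) - star (a n k) • u n k with hw'
  -- Let `M*` act on `u_k` on the left and `M` on `u_l` on the right: the eigenvalues give `(a_k -
  -- a_l) T_kl`, and only the two errors remain. Bessel's inequality, in `l` for the first and in
  -- `k` for the second, bounds their `ℓ²` norms.
  have key : ∀ k l, ⟪u n k, (M * T - T * M) (u n l)⟫_ℂ - (a n k - a n l) * ⟪u n k, T (u n l)⟫_ℂ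
      = ⟪star T (w' k), u n l⟫_ℂ + -⟪u n k, T (w l)⟫_ℂ := by
    intro k l
    rw [ContinuousLinearMap.star_eq_adjoint, ContinuousLinearMap.adjoint_inner_left, hw, hw']
    simp only [sub_apply, mul_apply_eq_comp, map_sub, map_smul, inner_sub_left, inner_sub_right,
      inner_smul_left, inner_smul_right, ContinuousLinearMap.star_eq_adjoint,
      ContinuousLinearMap.adjoint_inner_left, RCLike.star_def, Complex.conj_conj]
    ring
  simp_rw [key]
  refine (matNorm_add_le _ _ _).trans (add_le_add ?_ ?_)
  · refine Real.sqrt_le_sqrt (Finset.sum_le_sum fun k _ => ?_)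
    simp_rw [norm_inner_symm (star T (w' k))]
    exact (hu n).sum_inner_products_le _
  · rw [matNorm_neg, matNorm, Finset.sum_comm]
    exact Real.sqrt_le_sqrt (Finset.sum_le_sum fun l _ => (hu n).sum_inner_products_le _)

/-- Comparison of commutators: if the approximate eigenvalues of `M` vary less than those of `N`,
then `|[M, T]|₂ ≤ |[N, T]|₂` for approximable `T`. -/
theorem AlmostDiag.hsNorm_commutator_le {M N : H →L[ℂ] H} {ι : ℕ → Type*}
    {s : ∀ n, Finset (ι n)} {u : ∀ n, ι n → H} {a b : ∀ n, ι n → ℂ}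
    (hu : ∀ n, Orthonormal ℂ (u n))
    (hlim : ∀ x, Tendsto (fun n => frameProj (s n) (u n) x) atTop (𝓝 x))
    (hM : AlmostDiag M s u a) (hM' : AlmostDiag (star M) s u (fun n k => star (a n k)))
    (hN : AlmostDiag N s u b) (hN' : AlmostDiag (star N) s u (fun n k => star (b n k)))
    (hab : ∀ n k l, ‖a n k - a n l‖ ≤ ‖b n k - b n l‖) {T : H →L[ℂ] H}
    (hT : IsApproximable T) :
    hsNorm (M * T - T * M) ≤ hsNorm (N * T - T * N) := by
  by_cases hfin : IsHilbertSchmidt (N * T - T * N)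
  swap
  · have : hsNorm (N * T - T * N) = ∞ := by simpa [IsHilbertSchmidt] using hfin
    rw [this]
    exact le_top
  obtain ⟨e, he, hM⟩ := hM.exists_matNorm_commutator_le hu hM' hT
  obtain ⟨e', he', hN⟩ := hN.exists_matNorm_commutator_le hu hN' hT
  set c := (hsNorm (N * T - T * N)).toReal with hc
  rw [← ENNReal.ofReal_toReal hfin.ne]
  have hr : Tendsto (fun n => e n + (c + e' n)) atTop (𝓝 c) := by
    simpa using he.add (he'.const_add c)
  refine hsNorm_le_of_compressions hu hlim hr ENNReal.toReal_nonneg fun n => ?_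
  rw [← matNorm_sq]
  refine pow_le_pow_left₀ (Real.sqrt_nonneg _) ?_ 2
  -- Chain of comparisons: from the matrix of `[M, T]` to `(a_k - a_l) T_kl`, entrywise to `(b_k -
  -- b_l) T_kl`, and back to the matrix of `[N, T]`, with errors `e n` and `e' n`.
  have h1 : matNorm (s n) (fun k l => ⟪u n k, (M * T - T * M) (u n l)⟫_ℂ) ≤
      e n + matNorm (s n) (fun k l => (a n k - a n l) * ⟪u n k, T (u n l)⟫_ℂ) := by
    refine le_trans (le_of_eq ?_) ((matNorm_add_le (s n) _ _).trans (add_le_add_left (hM n) _))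
    simp only [sub_add_cancel]
  have h2 : matNorm (s n) (fun k l => (a n k - a n l) * ⟪u n k, T (u n l)⟫_ℂ) ≤
      matNorm (s n) (fun k l => (b n k - b n l) * ⟪u n k, T (u n l)⟫_ℂ) := by
    refine matNorm_mono _ fun k l => ?_
    rw [norm_mul, norm_mul]
    gcongr
    exact hab n k l
  have h3 : matNorm (s n) (fun k l => (b n k - b n l) * ⟪u n k, T (u n l)⟫_ℂ) ≤
      matNorm (s n) (fun k l => ⟪u n k, (N * T - T * N) (u n l)⟫_ℂ) + e' n := by
    have h4 := hN n
    rw [← matNorm_neg] at h4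
    refine le_trans (le_of_eq ?_) ((matNorm_add_le (s n) _ _).trans (add_le_add_right h4 _))
    congr 1
    funext k l
    ring
  have h5 : matNorm (s n) (fun k l => ⟪u n k, (N * T - T * N) (u n l)⟫_ℂ) ≤ c :=
    Real.sqrt_le_iff.2 ⟨ENNReal.toReal_nonneg, hfin.sum_sum_inner_sq_le (hu n) (s n)⟩
  change matNorm (s n) (fun k l => ⟪u n k, (M * T - T * M) (u n l)⟫_ℂ) ≤ _
  linarith

/-! ### The trace of a commutator -/

/-- For finite rank both products are separately of trace class, and both traces equal `∑ ⟨b_i, N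
a_i⟩`. -/
theorem trace_commutator_sum_rankOne {ι : Type*} (s : Finset ι) (a b : ι → H) (N : H →L[ℂ] H) :
    IsTraceClass (N * (∑ i ∈ s, rankOne ℂ (a i) (b i)) - (∑ i ∈ s, rankOne ℂ (a i) (b i)) * N) ∧
    trace (N * (∑ i ∈ s, rankOne ℂ (a i) (b i)) - (∑ i ∈ s, rankOne ℂ (a i) (b i)) * N) = 0 := by
  have e1 : N * (∑ i ∈ s, rankOne ℂ (a i) (b i)) = ∑ i ∈ s, rankOne ℂ (N (a i)) (b i) := by
    rw [Finset.mul_sum]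
    simp_rw [mul_rankOne]
  have e2 : (∑ i ∈ s, rankOne ℂ (a i) (b i)) * N = ∑ i ∈ s, rankOne ℂ (a i) (star N (b i)) := by
    rw [Finset.sum_mul]
    simp_rw [rankOne_mul]
  have t1 : ∀ p q : ι → H, IsTraceClass (∑ i ∈ s, rankOne ℂ (p i) (q i)) := fun p q =>
    (traceClassSubmodule H).sum_mem fun i _ => isTraceClass_rankOne (p i) (q i)
  rw [e1, e2]
  refine ⟨(t1 _ _).sub (t1 _ _), ?_⟩
  rw [(t1 _ _).trace_sub (t1 _ _), sub_eq_zero]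
  have h1 := trace_sum_rankOne_mul s (fun i => N (a i)) b (1 : H →L[ℂ] H)
  have h2 := trace_sum_rankOne_mul s a (fun i => star N (b i)) (1 : H →L[ℂ] H)
  rw [mul_one] at h1 h2
  rw [h1, h2]
  refine Finset.sum_congr rfl fun i _ => ?_
  rw [ContinuousLinearMap.star_eq_adjoint, ContinuousLinearMap.adjoint_inner_left]
  rfl

/-- On the diagonal of the matrix of `[N, X]` the eigenvalues cancel and only errors paired with `X
u_k` or `X* u_k` survive. Cauchy--Schwarz against the uniform error bound gives a constant
independent of `n` and `X`; the limit in `n` yields the trace. -/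
theorem AlmostDiag.exists_norm_trace_commutator_le {N : H →L[ℂ] H} {ι : ℕ → Type*}
    {s : ∀ n, Finset (ι n)} {u : ∀ n, ι n → H} {b : ∀ n, ι n → ℂ}
    (hu : ∀ n, Orthonormal ℂ (u n))
    (hlim : ∀ x, Tendsto (fun n => frameProj (s n) (u n) x) atTop (𝓝 x))
    (hN : AlmostDiag N s u b) (hN' : AlmostDiag (star N) s u (fun n k => star (b n k))) :
    ∃ C : ℝ, ∀ X : H →L[ℂ] H, IsHilbertSchmidt X → IsTraceClass (N * X - X * N) →
      ‖trace (N * X - X * N)‖ ≤ C * (hsNorm X).toReal := by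
  obtain ⟨C, hC⟩ := hN.bounded
  obtain ⟨C', hC'⟩ := hN'.bounded
  refine ⟨√C' + √C, fun X hX hY => ?_⟩
  refine le_of_tendsto (tendsto_trace_frameProj_mul hu hlim hY).norm
    (Eventually.of_forall fun n => ?_)
  rw [frameProj, trace_sum_rankOne_mul]
  set w : ι n → H := fun k => N (u n k) - b n k • u n k with hw
  set w' : ι n → H := fun k => star N (u n k) - star (b n k) • u n k with hw'
  have key : ∀ k, ⟪u n k, (N * X - X * N) (u n k)⟫_ℂ
      = ⟪w' k, X (u n k)⟫_ℂ - ⟪star X (u n k), w k⟫_ℂ := by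
    intro k
    rw [hw, hw']
    simp only [sub_apply, mul_apply_eq_comp, inner_sub_left, inner_sub_right,
      inner_smul_left, inner_smul_right, ContinuousLinearMap.star_eq_adjoint,
      ContinuousLinearMap.adjoint_inner_left, RCLike.star_def, Complex.conj_conj]
    ring
  have cs : ∀ (p q : ι n → H) (D h : ℝ), 0 ≤ h → ∑ k ∈ s n, ‖p k‖ ^ 2 ≤ D →
      ∑ k ∈ s n, ‖q k‖ ^ 2 ≤ h ^ 2 → ∑ k ∈ s n, ‖p k‖ * ‖q k‖ ≤ √D * h := by
    intro p q D h hh hp hq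
    refine (Real.sum_mul_le_sqrt_mul_sqrt _ _ _).trans ?_
    gcongr
    exact (Real.sqrt_le_left hh).2 hq
  have h1 := cs w' (fun k => X (u n k)) C' _ ENNReal.toReal_nonneg (hC' n)
    (hX.sum_norm_apply_sq_le (hu n) (s n))
  have h2 := cs w (fun k => star X (u n k)) C _ ENNReal.toReal_nonneg (hC n)
    (hX.star.sum_norm_apply_sq_le (hu n) (s n))
  rw [hsNorm_star] at h2
  calc ‖∑ k ∈ s n, ⟪u n k, (N * X - X * N) (u n k)⟫_ℂ‖
      ≤ ∑ k ∈ s n, (‖w' k‖ * ‖X (u n k)‖ + ‖w k‖ * ‖star X (u n k)‖) := by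
        refine (norm_sum_le _ _).trans (Finset.sum_le_sum fun k _ => ?_)
        rw [key, mul_comm ‖w k‖]
        exact (norm_sub_le _ _).trans (add_le_add (norm_inner_le_norm _ _)
          (norm_inner_le_norm _ _))
    _ ≤ √C' * (hsNorm X).toReal + √C * (hsNorm X).toReal := by
        rw [Finset.sum_add_distrib]
        exact add_le_add h1 h2
    _ = _ := by ring

/-- The commutator of an almost diagonal operator with a Hilbert--Schmidt operator has trace zero
as soon as it is of trace class. -/
theorem AlmostDiag.trace_commutator_eq_zero {N : H →L[ℂ] H} {ι : ℕ → Type*}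
    {s : ∀ n, Finset (ι n)} {u : ∀ n, ι n → H} {b : ∀ n, ι n → ℂ}
    (hu : ∀ n, Orthonormal ℂ (u n))
    (hlim : ∀ x, Tendsto (fun n => frameProj (s n) (u n) x) atTop (𝓝 x))
    (hN : AlmostDiag N s u b) (hN' : AlmostDiag (star N) s u (fun n k => star (b n k)))
    {X : H →L[ℂ] H} (hX : IsHilbertSchmidt X) (hY : IsTraceClass (N * X - X * N)) :
    trace (N * X - X * N) = 0 := by
  obtain ⟨C, hC⟩ := hN.exists_norm_trace_commutator_le hu hlim hN'
  have hsmall := tendsto_hsNorm_sub_frameProj_mul (fun _ : Finset (basisSet H) =>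
    (basis H).orthonormal) tendsto_frameProj_basis hX
  have h1 := ((ENNReal.tendsto_toReal ENNReal.zero_ne_top).comp hsmall).const_mul C
  rw [ENNReal.toReal_zero, mul_zero] at h1
  refine norm_le_zero_iff.1 (ge_of_tendsto h1 (Eventually.of_forall fun t => ?_))
  obtain ⟨h2, h3⟩ := trace_commutator_sum_rankOne t (basis H)
    (fun i => star X (basis H i)) N
  rw [← frameProj_mul] at h2 h3
  -- Removing the finite-rank operator `P_t X` leaves the trace of the commutator unchanged, while
  -- `|X - P_t X|₂` can be made arbitrarily small.
  have e : N * (X - frameProj t (basis H) * X) - (X - frameProj t (basis H) * X) * N =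
      (N * X - X * N) - (N * (frameProj t (basis H) * X) - frameProj t (basis H) * X * N) := by
    rw [mul_sub, sub_mul]
    abel
  have h4 := hC (X - frameProj t (basis H) * X) (hX.sub (hX.mul_left _)) (by
    rw [e]; exact hY.sub h2)
  rwa [e, hY.trace_sub h2, h3, sub_zero] at h4

end Frames

/-! ### Diagonalizing multiplication operators along square grids. -/

section Grid

set_option linter.unusedSectionVars false

variable {Ω : Set ℂ}

/-! ### Multiplication operators -/

theorem mulOp_coeFn (g : Lp ℂ ∞ (leb Ω)) (v : L2 Ω) :
    mulOp g v =ᵐ[leb Ω] fun x => g x * v x :=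
  ContinuousLinearMap.coeFn_holder (ContinuousLinearMap.mul ℂ ℂ) g v

theorem star_mulOp (g : Lp ℂ ∞ (leb Ω)) : star (mulOp g) = mulOp (star g) := by
  rw [ContinuousLinearMap.star_eq_adjoint, eq_comm, ContinuousLinearMap.eq_adjoint_iff]
  intro v w
  rw [L2.inner_def, L2.inner_def]
  refine integral_congr_ae ?_
  filter_upwards [mulOp_coeFn (star g) v, mulOp_coeFn g w, Lp.coeFn_star g] with x h1 h2 h3
  rw [h1, h2, h3]
  simp [RCLike.inner_apply]
  ring

/-- `v` vanishes almost everywhere off `A`. -/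
def SuppOn (A : Set ℂ) (v : L2 Ω) : Prop := ∀ᵐ x ∂(leb Ω), x ∉ A → v x = 0

theorem SuppOn.inner_eq_zero {A B : Set ℂ} {v w : L2 Ω} (hv : SuppOn A v) (hw : SuppOn B w)
    (hAB : Disjoint A B) : ⟪v, w⟫_ℂ = 0 := by
  rw [L2.inner_def]
  refine integral_eq_zero_of_ae ?_
  filter_upwards [hv, hw] with x h1 h2
  by_cases hx : x ∈ A
  · simp [h2 (Set.disjoint_left.1 hAB hx)]
  · simp [h1 hx]

theorem mulOp_sub_smul_coeFn (g : Lp ℂ ∞ (leb Ω)) (c : ℂ) (v : L2 Ω) :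
    (mulOp g v - c • v : L2 Ω) =ᵐ[leb Ω] fun x => (g x - c) * v x := by
  filter_upwards [mulOp_coeFn g v, Lp.coeFn_sub (mulOp g v) (c • v), Lp.coeFn_smul c v]
    with x h1 h2 h3
  rw [h2, Pi.sub_apply, h1, h3, Pi.smul_apply, smul_eq_mul, sub_mul]

theorem SuppOn.mulOp_sub_smul {A : Set ℂ} {v : L2 Ω} (hv : SuppOn A v) (g : Lp ℂ ∞ (leb Ω))
    (c : ℂ) : SuppOn A (mulOp g v - c • v) := by
  filter_upwards [hv, mulOp_sub_smul_coeFn g c v] with x h1 h2 hx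
  rw [h2, h1 hx, mul_zero]

theorem SuppOn.norm_mulOp_sub_smul_le {A : Set ℂ} {v : L2 Ω} (hv : SuppOn A v)
    {g : Lp ℂ ∞ (leb Ω)} {c : ℂ} {δ : ℝ} (h : ∀ᵐ x ∂(leb Ω), x ∈ A → ‖g x - c‖ ≤ δ) :
    ‖mulOp g v - c • v‖ ≤ δ * ‖v‖ := by
  refine Lp.norm_le_mul_norm_of_ae_le_mul ?_
  filter_upwards [hv, mulOp_sub_smul_coeFn g c v, h] with x h1 h2 h3
  rw [h2, norm_mul]
  by_cases hx : x ∈ A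
  · gcongr
    exact h3 hx
  · simp [h1 hx]

/-- Bessel's inequality for orthogonal vectors that need not be normalized and may vanish. With `S`
the sum and `y = ∑ ⟨w_k, ξ⟩ w_k`, one has `⟨ξ, y⟩ = S` and `‖y‖² ≤ δ² S`; Cauchy--Schwarz then
bounds `S`. -/
theorem sum_norm_inner_sq_le_of_pairwise_orthogonal {H : Type*} [NormedAddCommGroup H]
    [InnerProductSpace ℂ H] {ι : Type*} (s : Finset ι) {w : ι → H} {δ : ℝ}
    (hδ : ∀ k, ‖w k‖ ≤ δ) (hw : Pairwise fun k l => ⟪w k, w l⟫_ℂ = 0) (ξ : H) :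
    ∑ k ∈ s, ‖⟪ξ, w k⟫_ℂ‖ ^ 2 ≤ δ ^ 2 * ‖ξ‖ ^ 2 := by
  set S := ∑ k ∈ s, ‖⟪ξ, w k⟫_ℂ‖ ^ 2 with hS
  have hS0 : 0 ≤ S := by positivity
  set y := ∑ k ∈ s, ⟪w k, ξ⟫_ℂ • w k with hy
  have h1 : ⟪ξ, y⟫_ℂ = (S : ℂ) := by
    rw [hy, inner_sum, hS]
    push_cast
    refine Finset.sum_congr rfl fun k _ => ?_
    rw [inner_smul_right, ← inner_conj_symm, Complex.conj_mul']
  have h2 : ‖y‖ ^ 2 ≤ δ ^ 2 * S := by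
    have h3 : ((‖y‖ ^ 2 : ℝ) : ℂ) = ((∑ k ∈ s, ‖⟪ξ, w k⟫_ℂ‖ ^ 2 * ‖w k‖ ^ 2 : ℝ) : ℂ) := by
      have h4 : ((‖y‖ ^ 2 : ℝ) : ℂ) = ⟪y, y⟫_ℂ := by
        rw [inner_self_eq_norm_sq_to_K]; push_cast; rfl
      rw [h4]
      conv_lhs => rw [hy, sum_inner]
      push_cast
      refine Finset.sum_congr rfl fun k hk => ?_
      rw [inner_sum, Finset.sum_eq_single k]
      · rw [inner_smul_left, inner_smul_right, inner_self_eq_norm_sq_to_K, ← mul_assoc,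
          Complex.conj_mul', norm_inner_symm]
        rfl
      · intro l _ hl
        rw [inner_smul_left, inner_smul_right, hw hl.symm, mul_zero, mul_zero]
      · exact fun h => absurd hk h
    rw [Complex.ofReal_injective h3, hS, Finset.mul_sum]
    refine Finset.sum_le_sum fun k _ => ?_
    rw [mul_comm]
    gcongr
    exact hδ k
  have h5 : S ≤ ‖ξ‖ * ‖y‖ := by
    have h6 := norm_inner_le_norm (𝕜 := ℂ) ξ y
    rwa [h1, Complex.norm_real, Real.norm_of_nonneg hS0] at h6
  rcases hS0.eq_or_lt with h0 | h0
  · rw [← h0]; positivity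
  · have h7 : S ^ 2 ≤ ‖ξ‖ ^ 2 * (δ ^ 2 * S) := by
      calc S ^ 2 ≤ (‖ξ‖ * ‖y‖) ^ 2 := by gcongr
        _ = ‖ξ‖ ^ 2 * ‖y‖ ^ 2 := mul_pow _ _ _
        _ ≤ _ := by gcongr
    nlinarith

/-! ### The grid -/

/-- The half-open square of the grid of mesh `1 / (n + 1)` with index `k`. -/
def cell (n : ℕ) (k : ℤ × ℤ) : Set ℂ :=
  {z | ⌊(n + 1) * z.re⌋ = k.1 ∧ ⌊(n + 1) * z.im⌋ = k.2}

theorem measurableSet_cell (n : ℕ) (k : ℤ × ℤ) : MeasurableSet (cell n k) := by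
  refine MeasurableSet.inter ?_ ?_
  · exact (Int.measurable_floor.comp (Complex.measurable_re.const_mul _))
      (measurableSet_singleton k.1)
  · exact (Int.measurable_floor.comp (Complex.measurable_im.const_mul _))
      (measurableSet_singleton k.2)

theorem disjoint_cell (n : ℕ) {k l : ℤ × ℤ} (h : k ≠ l) : Disjoint (cell n k) (cell n l) := by
  refine Set.disjoint_left.2 fun z hk hl => h ?_
  exact Prod.ext (hk.1.symm.trans hl.1) (hk.2.symm.trans hl.2)

theorem norm_sub_le_of_mem_cell {n : ℕ} {k : ℤ × ℤ} {z w : ℂ} (hz : z ∈ cell n k)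
    (hw : w ∈ cell n k) : ‖z - w‖ ≤ 2 / (n + 1) := by
  have hn : (0 : ℝ) < n + 1 := by positivity
  have h1 : ∀ x y : ℝ, ⌊(n + 1) * x⌋ = ⌊(n + 1) * y⌋ → |x - y| ≤ 1 / (n + 1) := by
    intro x y h
    have := (Int.abs_sub_lt_one_of_floor_eq_floor h).le
    rw [← mul_sub, abs_mul, abs_of_pos hn] at this
    rw [le_div_iff₀ hn]
    linarith
  calc ‖z - w‖ ≤ |(z - w).re| + |(z - w).im| := Complex.norm_le_abs_re_add_abs_im _
    _ ≤ 1 / (n + 1) + 1 / (n + 1) := by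
        rw [Complex.sub_re, Complex.sub_im]
        exact add_le_add (h1 _ _ (hz.1.trans hw.1.symm)) (h1 _ _ (hz.2.trans hw.2.symm))
    _ = 2 / (n + 1) := by ring

/-- The indices of the grid squares that meet `Ω` in positive measure. -/
abbrev CellIdx (Ω : Set ℂ) (n : ℕ) : Type := {k : ℤ × ℤ // leb Ω (cell n k) ≠ 0}

theorem exists_box (hb : Bornology.IsBounded Ω) : ∃ R : ℕ, ∀ n : ℕ,
    ∀ k : CellIdx Ω n, k.1 ∈ Finset.Icc (-(((n + 1) * R : ℕ) : ℤ)) ((n + 1) * R : ℕ) ×ˢ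
      Finset.Icc (-(((n + 1) * R : ℕ) : ℤ)) ((n + 1) * R : ℕ) := by
  obtain ⟨C, hC⟩ := hb.exists_norm_le
  obtain ⟨R, hR⟩ := exists_nat_ge C
  refine ⟨R, fun n k => ?_⟩
  have hn : (0 : ℝ) ≤ n + 1 := by positivity
  obtain ⟨z, hz, hzΩ⟩ : (cell n k.1 ∩ Ω).Nonempty := by
    refine nonempty_of_measure_ne_zero (μ := volume) ?_
    rw [← Measure.restrict_apply (measurableSet_cell n k.1)]
    exact k.2
  have h1 : ∀ x : ℝ, |x| ≤ ‖z‖ → ⌊(n + 1) * x⌋ ∈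
      Finset.Icc (-(((n + 1) * R : ℕ) : ℤ)) ((n + 1) * R : ℕ) := by
    intro x hx
    have h2 : |x| ≤ R := hx.trans ((hC z hzΩ).trans hR)
    have h3 := abs_le.1 h2
    rw [Finset.mem_Icc, Int.le_floor]
    constructor
    · push_cast
      nlinarith [h3.1]
    · rw [← Int.floor_natCast (R := ℝ)]
      refine Int.floor_le_floor ?_
      push_cast
      nlinarith [h3.2]
  rw [Finset.mem_product, ← hz.1, ← hz.2]
  exact ⟨h1 _ (Complex.abs_re_le_norm z), h1 _ (Complex.abs_im_le_norm z)⟩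

theorem finite_cellIdx (hb : Bornology.IsBounded Ω) (n : ℕ) :
    Finite (CellIdx Ω n) := by
  obtain ⟨R, hR⟩ := exists_box hb
  exact Finite.of_injective (fun k => (⟨k.1, hR n k⟩ : (_ : Finset (ℤ × ℤ))))
    fun k l h => Subtype.ext (congrArg (fun p => p.1) h)

/-- The finite set of all indices of grid squares that meet `Ω` in positive measure. -/
noncomputable def cells (hb : Bornology.IsBounded Ω) (n : ℕ) : Finset (CellIdx Ω n) :=
  @Finset.univ _ (@Fintype.ofFinite _ (finite_cellIdx hb n))

theorem mem_cells (hb : Bornology.IsBounded Ω) (n : ℕ) (k : CellIdx Ω n) : k ∈ cells hb n :=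
  @Finset.mem_univ _ (@Fintype.ofFinite _ (finite_cellIdx hb n)) k

/-- The quadratic growth is where planarity enters: it is exactly balanced by the squared errors of
order `(n+1)⁻²`. -/
theorem exists_card_cells_le (hb : Bornology.IsBounded Ω) :
    ∃ C : ℝ, 0 ≤ C ∧ ∀ n : ℕ, ((cells hb n).card : ℝ) ≤ C * (n + 1) ^ 2 := by
  obtain ⟨R, hR⟩ := exists_box hb
  refine ⟨(2 * R + 1) ^ 2, by positivity, fun n => ?_⟩
  have h1 := Finset.card_le_card_of_injOn (s := cells hb n) (fun k => k.1)
    (fun k _ => hR n k) (fun k _ l _ h => Subtype.ext h)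
  rw [Finset.card_product, Int.card_Icc] at h1
  have h2 : ((((n + 1) * R : ℕ) : ℤ) + 1 - -(((n + 1) * R : ℕ) : ℤ)).toNat
      = 2 * ((n + 1) * R) + 1 := by omega
  rw [h2] at h1
  have h3 : ((cells hb n).card : ℝ) ≤ (2 * ((n + 1) * R) + 1) * (2 * ((n + 1) * R) + 1) := by
    exact_mod_cast h1
  refine h3.trans ?_
  rw [← sq, ← mul_pow]
  have hn : (0 : ℝ) ≤ n := by positivity
  gcongr
  nlinarith

theorem isFiniteMeasure_leb (hb : Bornology.IsBounded Ω) : IsFiniteMeasure (leb Ω) :=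
  ⟨by rw [Measure.restrict_apply_univ]; exact hb.measure_lt_top⟩

theorem leb_ne_top (hb : Bornology.IsBounded Ω) (A : Set ℂ) : leb Ω A ≠ ∞ :=
  have := isFiniteMeasure_leb hb
  measure_ne_top _ A

/-- The indicator function of a grid square. -/
noncomputable def cellInd (hb : Bornology.IsBounded Ω) (n : ℕ) (k : CellIdx Ω n) : L2 Ω :=
  indicatorConstLp 2 (measurableSet_cell n k.1) (leb_ne_top hb _) 1

/-- The normalized indicator function of a grid square. -/
noncomputable def cellVec (hb : Bornology.IsBounded Ω) (n : ℕ) (k : CellIdx Ω n) : L2 Ω :=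
  ((‖cellInd hb n k‖ : ℂ)⁻¹) • cellInd hb n k

theorem cellInd_ne_zero (hb : Bornology.IsBounded Ω) (n : ℕ) (k : CellIdx Ω n) :
    cellInd hb n k ≠ 0 := by
  rw [← norm_ne_zero_iff, cellInd, norm_indicatorConstLp two_ne_zero ENNReal.ofNat_ne_top]
  have : 0 < (leb Ω).real (cell n k.1) :=
    ENNReal.toReal_pos k.2 (leb_ne_top hb _)
  rw [norm_one, one_mul]
  positivity

theorem cellInd_eq_smul (hb : Bornology.IsBounded Ω) (n : ℕ) (k : CellIdx Ω n) :
    cellInd hb n k = (‖cellInd hb n k‖ : ℂ) • cellVec hb n k := by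
  rw [cellVec, smul_smul, mul_inv_cancel₀, one_smul]
  simpa using cellInd_ne_zero hb n k

theorem norm_cellVec (hb : Bornology.IsBounded Ω) (n : ℕ) (k : CellIdx Ω n) :
    ‖cellVec hb n k‖ = 1 := by
  rw [cellVec, norm_smul, norm_inv, Complex.norm_real, norm_norm,
    inv_mul_cancel₀ (norm_ne_zero_iff.2 (cellInd_ne_zero hb n k))]

theorem suppOn_cellVec (hb : Bornology.IsBounded Ω) (n : ℕ) (k : CellIdx Ω n) :
    SuppOn (cell n k.1) (cellVec hb n k) := by
  filter_upwards [Lp.coeFn_smul ((‖cellInd hb n k‖ : ℂ)⁻¹) (cellInd hb n k),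
    indicatorConstLp_coeFn_notMem (p := 2) (hs := measurableSet_cell n k.1)
      (hμs := leb_ne_top hb (cell n k.1)) (c := (1 : ℂ))] with x h1 h2 hx
  rw [cellVec, h1, Pi.smul_apply, cellInd, h2 hx, smul_zero]

theorem orthonormal_cellVec (hb : Bornology.IsBounded Ω) (n : ℕ) :
    Orthonormal ℂ (cellVec hb n) := by
  refine ⟨norm_cellVec hb n, fun k l h => ?_⟩
  exact (suppOn_cellVec hb n k).inner_eq_zero (suppOn_cellVec hb n l)
    (disjoint_cell n fun e => h (Subtype.ext e))

theorem tendsto_two_div : Tendsto (fun n : ℕ => (2 : ℝ) / (n + 1)) atTop (𝓝 0) := by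
  have := (tendsto_one_div_add_atTop_nhds_zero_nat (𝕜 := ℝ)).const_mul 2
  simpa only [mul_one_div, mul_zero] using this

/-- Multiplication operators are almost diagonal along the grid. -/
theorem almostDiag_mulOp (hb : Bornology.IsBounded Ω) {g : Lp ℂ ∞ (leb Ω)}
    {a : ∀ n, CellIdx Ω n → ℂ}
    (h : ∀ n (k : CellIdx Ω n), ∀ᵐ x ∂(leb Ω), x ∈ cell n k.1 → ‖g x - a n k‖ ≤ 2 / (n + 1)) :
    AlmostDiag (mulOp g) (cells hb) (cellVec hb) a := by
  have hw : ∀ n k, ‖mulOp g (cellVec hb n k) - a n k • cellVec hb n k‖ ≤ 2 / (n + 1) := by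
    intro n k
    have := (suppOn_cellVec hb n k).norm_mulOp_sub_smul_le (h n k)
    rwa [norm_cellVec, mul_one] at this
  constructor
  · obtain ⟨C, hC0, hC⟩ := exists_card_cells_le hb
    refine ⟨4 * C, fun n => ?_⟩
    have hn : (0 : ℝ) < n + 1 := by positivity
    calc ∑ k ∈ cells hb n, ‖mulOp g (cellVec hb n k) - a n k • cellVec hb n k‖ ^ 2
        ≤ ∑ k ∈ cells hb n, ((2 : ℝ) / (n + 1)) ^ 2 := by
          gcongr with k _
          exact hw n k
      _ = (cells hb n).card * ((2 : ℝ) / (n + 1)) ^ 2 := by rw [Finset.sum_const, nsmul_eq_mul]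
      _ ≤ C * (n + 1) ^ 2 * ((2 : ℝ) / (n + 1)) ^ 2 := by
          gcongr
          exact hC n
      _ = 4 * C := by field_simp; ring
  · intro ξ
    have h1 : Tendsto (fun n : ℕ => ((2 : ℝ) / (n + 1)) ^ 2 * ‖ξ‖ ^ 2) atTop (𝓝 0) := by
      simpa using (tendsto_two_div.pow 2).mul_const (‖ξ‖ ^ 2)
    refine squeeze_zero (fun n => by positivity) (fun n => ?_) h1
    -- Each error is supported in its own square, so the errors are mutually orthogonal and the
    -- number of squares does not enter.
    refine sum_norm_inner_sq_le_of_pairwise_orthogonal _ (hw n) (fun k l hkl => ?_) ξ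
    exact ((suppOn_cellVec hb n k).mulOp_sub_smul g _).inner_eq_zero
      ((suppOn_cellVec hb n l).mulOp_sub_smul g _) (disjoint_cell n fun e => hkl (Subtype.ext e))

theorem almostDiag_star_mulOp (hb : Bornology.IsBounded Ω) {g : Lp ℂ ∞ (leb Ω)}
    {a : ∀ n, CellIdx Ω n → ℂ}
    (h : ∀ n (k : CellIdx Ω n), ∀ᵐ x ∂(leb Ω), x ∈ cell n k.1 → ‖g x - a n k‖ ≤ 2 / (n + 1)) :
    AlmostDiag (star (mulOp g)) (cells hb) (cellVec hb) (fun n k => star (a n k)) := by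
  rw [star_mulOp]
  refine almostDiag_mulOp hb fun n k => ?_
  filter_upwards [h n k, Lp.coeFn_star g] with x h1 h2 hx
  rw [h2, Pi.star_apply, ← star_sub, norm_star]
  exact h1 hx

theorem frameProj_cellInd (hb : Bornology.IsBounded Ω) (n : ℕ) (k : CellIdx Ω n) :
    frameProj (cells hb n) (cellVec hb n) (cellInd hb n k) = cellInd hb n k := by
  rw [cellInd_eq_smul, map_smul, frameProj_apply, Finset.sum_eq_single k]
  · rw [inner_self_eq_norm_sq_to_K, norm_cellVec]
    simp
  · intro l _ hl
    rw [(orthonormal_cellVec hb n).2 hl, zero_smul]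
  · exact fun h => absurd (mem_cells hb n k) h

/-- Only countably many squares are discarded, and each of them is null. -/
theorem ae_exists_mem_cell (n : ℕ) :
    ∀ᵐ x ∂(leb Ω), ∃ k : CellIdx Ω n, x ∈ cell n k.1 := by
  have h1 : ∀ᵐ x ∂(leb Ω), ∀ k : ℤ × ℤ, leb Ω (cell n k) = 0 → x ∉ cell n k := by
    rw [ae_all_iff]
    intro k
    by_cases hk : leb Ω (cell n k) = 0
    · filter_upwards [measure_eq_zero_iff_ae_notMem.1 hk] with x hx _
      exact hx
    · exact Eventually.of_forall fun x h => absurd h hk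
  filter_upwards [h1] with x hx
  have hmem : x ∈ cell n (⌊(n + 1) * x.re⌋, ⌊(n + 1) * x.im⌋) := ⟨rfl, rfl⟩
  exact ⟨⟨_, fun h => hx _ h hmem⟩, hmem⟩

theorem sum_smul_cellInd_coeFn (hb : Bornology.IsBounded Ω) (n : ℕ) (c : CellIdx Ω n → ℂ) :
    ∀ᵐ x ∂(leb Ω), ∀ k : CellIdx Ω n, x ∈ cell n k.1 →
      (∑ l ∈ cells hb n, c l • cellInd hb n l : L2 Ω) x = c k := by
  have h1 : ∀ᵐ x ∂(leb Ω), ∀ l : CellIdx Ω n, (c l • cellInd hb n l : L2 Ω) x =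
      c l • (cell n l.1).indicator (fun _ => (1 : ℂ)) x := by
    rw [ae_all_iff]
    intro l
    filter_upwards [Lp.coeFn_smul (c l) (cellInd hb n l),
      indicatorConstLp_coeFn (p := 2) (hs := measurableSet_cell n l.1)
      (hμs := leb_ne_top hb (cell n l.1)) (c := (1 : ℂ))] with x h1 h2
    rw [h1, Pi.smul_apply, cellInd, h2]
  filter_upwards [h1, Lp.coeFn_finsetSum (cells hb n) fun l => c l • cellInd hb n l]
    with x h2 h3 k hk
  rw [h3, Finset.sum_apply, Finset.sum_eq_single k]
  · rw [h2, Set.indicator_of_mem hk, smul_eq_mul, mul_one]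
  · intro l _ hl
    rw [h2, Set.indicator_of_notMem, smul_zero]
    exact Set.disjoint_left.1 (disjoint_cell n fun e => hl (Subtype.ext e.symm)) hk
  · exact fun h => absurd (mem_cells hb n k) h

/-- Approximate `v` in `L²` by a compactly supported continuous function, hence a uniformly
continuous one, and that by a step function on the grid, which the projection fixes. Both errors are
at most `ε/5`, and `‖1 - P‖ ≤ 2` turns `2ε/5` into `4ε/5`. -/
theorem tendsto_frameProj_cellVec (hb : Bornology.IsBounded Ω) (v : L2 Ω) :
    Tendsto (fun n => frameProj (cells hb n) (cellVec hb n) v) atTop (𝓝 v) := by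
  have := isFiniteMeasure_leb hb
  rw [Metric.tendsto_atTop]
  intro ε hε
  obtain ⟨h, hcs, hvh, hcont, hmem⟩ := (Lp.memLp v).exists_hasCompactSupport_eLpNorm_sub_le
    ENNReal.ofNat_ne_top (ε := ENNReal.ofReal (ε / 5)) (by simpa using hε)
  set w : L2 Ω := hmem.toLp h with hw
  have hvw : ‖v - w‖ ≤ ε / 5 := by
    rw [Lp.norm_def]
    refine ENNReal.toReal_le_of_le_ofReal (by positivity) (le_trans (le_of_eq ?_) hvh)
    refine eLpNorm_congr_ae ?_
    filter_upwards [Lp.coeFn_sub v w, hmem.coeFn_toLp] with x h1 h2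
    rw [h1, Pi.sub_apply, Pi.sub_apply, h2]
  -- `D = λ(Ω)^(1/2)` converts a uniform bound into an `L²` bound; it may be zero, whence `D + 1` in
  -- the modulus of continuity below.
  set D : ℝ := (leb Ω).real Set.univ ^ (2 : ℝ≥0∞).toReal⁻¹ with hD
  have hD0 : 0 ≤ D := by positivity
  obtain ⟨δ, hδ, hunif⟩ := Metric.uniformContinuous_iff.1
    (hcs.uniformContinuous_of_continuous hcont) (ε / (5 * (D + 1))) (by positivity)
  obtain ⟨n₀, hn₀⟩ := (tendsto_two_div.eventually_lt_const hδ).exists_forall_of_atTop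
  refine ⟨n₀, fun n hn => ?_⟩
  have hz : ∀ k : CellIdx Ω n, ∃ z, z ∈ cell n k.1 := fun k => nonempty_of_measure_ne_zero k.2
  choose z hz using hz
  set y : L2 Ω := ∑ k ∈ cells hb n, h (z k) • cellInd hb n k with hy
  have hPy : frameProj (cells hb n) (cellVec hb n) y = y := by
    rw [hy, map_sum]
    exact Finset.sum_congr rfl fun k _ => by rw [map_smul, frameProj_cellInd]
  have hwy : ‖w - y‖ ≤ ε / 5 := by
    have h1 : ‖w - y‖ ≤ D * (ε / (5 * (D + 1))) := by
      rw [hD]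
      refine Lp.norm_le_of_ae_bound (by positivity) ?_
      filter_upwards [Lp.coeFn_sub w y, hmem.coeFn_toLp, ae_exists_mem_cell n,
        sum_smul_cellInd_coeFn hb n fun k => h (z k)] with x h1 h2 ⟨k, hk⟩ h4
      rw [h1, Pi.sub_apply, hw, h2, hy, h4 k hk, ← dist_eq_norm]
      refine (hunif ?_).le
      rw [dist_eq_norm]
      exact (norm_sub_le_of_mem_cell hk (hz k)).trans_lt (hn₀ n hn)
    refine h1.trans ?_
    rw [← mul_div_assoc, div_le_div_iff₀ (by positivity) (by positivity)]
    nlinarith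
  have hvy : ‖v - y‖ ≤ 2 * (ε / 5) := by
    have := norm_sub_le_norm_sub_add_norm_sub v w y
    linarith
  have hPvy : ‖frameProj (cells hb n) (cellVec hb n) (v - y)‖ ≤ 1 * ‖v - y‖ :=
    ContinuousLinearMap.le_of_opNorm_le _ (norm_frameProj_le (orthonormal_cellVec hb n) _) _
  rw [dist_eq_norm]
  have e : frameProj (cells hb n) (cellVec hb n) v - v =
      frameProj (cells hb n) (cellVec hb n) (v - y) - (v - y) := by
    rw [map_sub, hPy]; abel
  rw [e]
  linarith [norm_sub_le (frameProj (cells hb n) (cellVec hb n) (v - y)) (v - y)]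

/-! ### Essentially Lipschitz functions and the Lipschitz seminorm -/

/-- By Fubini, almost every `s` satisfies the bound against almost every `t`. Two such points are
compared through a third, good for both and close to `s`; it exists because `s` lies in the support
of the measure. This makes the Lipschitz bound hold for every pair of sample points. -/
theorem exists_conull_lipschitz {f : ℂ → ℂ} {μ : Measure ℂ} [SFinite μ]
    (hf : ∀ᵐ p ∂(μ.prod μ), ‖f p.1 - f p.2‖ ≤ ‖p.1 - p.2‖) :
    ∃ G : Set ℂ, (∀ᵐ x ∂μ, x ∈ G) ∧ ∀ s ∈ G, ∀ t ∈ G, ‖f s - f t‖ ≤ ‖s - t‖ := by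
  have h1 := Measure.ae_ae_of_ae_prod hf
  refine ⟨{s | (∀ᵐ t ∂μ, ‖f s - f t‖ ≤ ‖s - t‖) ∧ s ∈ μ.support}, ?_, ?_⟩
  · filter_upwards [h1, Measure.support_mem_ae] with s hs hs'
    exact ⟨hs, hs'⟩
  · rintro s ⟨hs, hsupp⟩ t ⟨ht, -⟩
    refine le_of_forall_pos_le_add fun ε hε => ?_
    have hpos := (Measure.mem_support_iff_forall s).1 hsupp _
      (Metric.ball_mem_nhds s (half_pos hε))
    obtain ⟨r, hr, hr1, hr2⟩ := ((frequently_ae_mem_iff.2 hpos.ne').and_eventually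
      (hs.and ht)).exists
    rw [Metric.mem_ball, dist_eq_norm] at hr
    have h2 : ‖f s - f t‖ ≤ ‖f s - f r‖ + ‖f t - f r‖ := by
      have := norm_sub_le (f s - f r) (f t - f r)
      rwa [sub_sub_sub_cancel_right] at this
    have h3 : ‖t - r‖ ≤ ‖s - t‖ + ‖r - s‖ := by
      have := norm_add_le (t - s) (s - r)
      rwa [sub_add_sub_cancel, norm_sub_rev t s, norm_sub_rev s r] at this
    rw [norm_sub_rev s r] at hr1
    linarith

theorem ae_norm_sub_le_of_eLpNorm_diffQuot_le {f : ℂ → ℂ} {μ : Measure (ℂ × ℂ)}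
    (hf : eLpNorm (diffQuot f) ∞ μ ≤ 1) :
    ∀ᵐ p ∂μ, ‖f p.1 - f p.2‖ ≤ ‖p.1 - p.2‖ := by
  rw [eLpNorm_exponent_top] at hf
  filter_upwards [ae_le_eLpNormEssSup (f := diffQuot f) (μ := μ)] with p hp
  -- On the diagonal both sides vanish, so its being null is not needed.
  rcases eq_or_ne p.1 p.2 with h | h
  · simp [h]
  · have h1 : ‖diffQuot f p‖ ≤ 1 := by
      have := hp.trans hf
      rwa [← ofReal_norm, ENNReal.ofReal_le_one] at this
    rwa [diffQuot, norm_div, div_le_one (norm_pos_iff.2 (sub_ne_zero.2 h))] at h1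

theorem opZ_symbol_coeFn (hm : MeasurableSet Ω) (hb : Bornology.IsBounded Ω) :
    (memLp_id hm hb).toLp (fun z : ℂ => z) =ᵐ[leb Ω] fun z => z :=
  (memLp_id hm hb).coeFn_toLp

theorem eLpNorm_diffQuot_id_le (hm : MeasurableSet Ω) (hb : Bornology.IsBounded Ω) :
    (memLp_id hm hb).toLp (fun z : ℂ => z) ∈ Lam Ω ∧
    eLpNorm (diffQuot ((memLp_id hm hb).toLp (fun z : ℂ => z))) ∞ ((leb Ω).prod (leb Ω)) ≤ 1 := by
  set g := (memLp_id hm hb).toLp (fun z : ℂ => z) with hg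
  have hmeas : Measurable (diffQuot g) := by
    have hgm : Measurable g := (Lp.stronglyMeasurable g).measurable
    unfold diffQuot
    fun_prop
  have hbd : ∀ᵐ p ∂((leb Ω).prod (leb Ω)), ‖diffQuot g p‖ ≤ 1 := by
    filter_upwards [Measure.quasiMeasurePreserving_fst.ae (opZ_symbol_coeFn hm hb),
      Measure.quasiMeasurePreserving_snd.ae (opZ_symbol_coeFn hm hb)] with p h1 h2
    rw [diffQuot, h1, h2, norm_div]
    exact div_self_le_one _
  refine ⟨memLp_top_of_bound hmeas.aestronglyMeasurable 1 hbd, ?_⟩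
  simpa using eLpNorm_le_of_ae_bound (p := ∞) hbd

/-- The Lipschitz seminorm of an approximable operator is attained at the coordinate function. -/
theorem lipNorm_eq (hm : MeasurableSet Ω) (hb : Bornology.IsBounded Ω) {T : Op Ω}
    (hT : IsApproximable T) : lipNorm T = hsNorm (comm (opZ hm hb) T) := by
  refine le_antisymm (iSup₂_le ?_) ?_
  · rintro f ⟨-, hf⟩
    obtain ⟨G, hG, hlip⟩ := exists_conull_lipschitz (ae_norm_sub_le_of_eLpNorm_diffQuot_le hf)
    -- Sample points are taken in the conull set `G`, and the same points serve for `f` and for the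
    -- coordinate function; hence the approximate eigenvalues compare exactly.
    have hz : ∀ n (k : CellIdx Ω n), ∃ z, z ∈ cell n k.1 ∧ z ∈ G := fun n k =>
      ((frequently_ae_mem_iff.2 k.2).and_eventually hG).exists
    choose z hz hzG using hz
    have h1 : ∀ n (k : CellIdx Ω n), ∀ᵐ x ∂(leb Ω), x ∈ cell n k.1 →
        ‖f x - f (z n k)‖ ≤ 2 / (n + 1) := by
      intro n k
      filter_upwards [hG] with x hx hxk
      exact (hlip x hx _ (hzG n k)).trans (norm_sub_le_of_mem_cell hxk (hz n k))
    have h2 : ∀ n (k : CellIdx Ω n), ∀ᵐ x ∂(leb Ω), x ∈ cell n k.1 →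
        ‖(memLp_id hm hb).toLp (fun z : ℂ => z) x - z n k‖ ≤ 2 / (n + 1) := by
      intro n k
      filter_upwards [opZ_symbol_coeFn hm hb] with x hx hxk
      rw [hx]
      exact norm_sub_le_of_mem_cell hxk (hz n k)
    exact AlmostDiag.hsNorm_commutator_le (orthonormal_cellVec hb) (tendsto_frameProj_cellVec hb)
      (almostDiag_mulOp hb h1) (almostDiag_star_mulOp hb h1) (almostDiag_mulOp hb h2)
      (almostDiag_star_mulOp hb h2) (fun n k l => hlip _ (hzG n k) _ (hzG n l)) hT
  · exact le_iSup₂ (f := fun (g : Lp ℂ ∞ (leb Ω)) _ => hsNorm (comm (mulOp g) T)) _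
      (eLpNorm_diffQuot_id_le hm hb)

theorem trace_comm_opZ_eq_zero (hm : MeasurableSet Ω) (hb : Bornology.IsBounded Ω) {X : Op Ω}
    (hX : IsHilbertSchmidt X) (hY : IsTraceClass (comm (opZ hm hb) X)) :
    trace (comm (opZ hm hb) X) = 0 := by
  have hz : ∀ n (k : CellIdx Ω n), ∃ z, z ∈ cell n k.1 := fun n k =>
    nonempty_of_measure_ne_zero k.2
  choose z hz using hz
  have h2 : ∀ n (k : CellIdx Ω n), ∀ᵐ x ∂(leb Ω), x ∈ cell n k.1 →
      ‖(memLp_id hm hb).toLp (fun z : ℂ => z) x - z n k‖ ≤ 2 / (n + 1) := by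
    intro n k
    filter_upwards [opZ_symbol_coeFn hm hb] with x hx hxk
    rw [hx]
    exact norm_sub_le_of_mem_cell hxk (hz n k)
  exact AlmostDiag.trace_commutator_eq_zero (orthonormal_cellVec hb)
    (tendsto_frameProj_cellVec hb) (almostDiag_mulOp hb h2) (almostDiag_star_mulOp hb h2) hX hY

end Grid

/-! ### Representation of functionals by trace-class and Hilbert--Schmidt operators. -/

section Duality

set_option linter.unusedSectionVars false

variable {H : Type*} [NormedAddCommGroup H] [InnerProductSpace ℂ H] [CompleteSpace H]

/-! ### Duality for compact operators and for Hilbert--Schmidt operators -/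

/-- The element of `C₂(H)` given by a Hilbert--Schmidt operator. -/
def HilbertSchmidt.ofOp (T : H →L[ℂ] H) (hT : IsHilbertSchmidt T) : HilbertSchmidt H := ⟨T, hT⟩

/-- The element of `C₁(H)` given by a trace-class operator. -/
def TraceClass.ofOp (T : H →L[ℂ] H) (hT : IsTraceClass T) : TraceClass H := ⟨T, hT⟩

theorem HilbertSchmidt.toOp_ofOp (T : H →L[ℂ] H) (hT : IsHilbertSchmidt T) :
    (HilbertSchmidt.ofOp T hT).toOp = T := rfl

theorem TraceClass.toOp_ofOp (T : H →L[ℂ] H) (hT : IsTraceClass T) :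
    (TraceClass.ofOp T hT).toOp = T := rfl

/-- The Riesz representation of a bounded sesquilinear form. It is applied to `ψ(|ξ⟩⟨η|)`, so that
`ψ` on rank-one operators becomes the matrix of an operator. -/
theorem exists_op_of_form (B : H → H → ℂ) (C : ℝ) (hB : ∀ η ξ, ‖B η ξ‖ ≤ C * ‖η‖ * ‖ξ‖)
    (h₁ : ∀ η η' ξ, B (η + η') ξ = B η ξ + B η' ξ)
    (h₂ : ∀ (c : ℂ) η ξ, B (c • η) ξ = starRingEnd ℂ c • B η ξ)
    (h₃ : ∀ η ξ ξ', B η (ξ + ξ') = B η ξ + B η ξ')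
    (h₄ : ∀ (c : ℂ) η ξ, B η (c • ξ) = c • B η ξ) :
    ∃ x : H →L[ℂ] H, ∀ η ξ, ⟪η, x ξ⟫_ℂ = B η ξ := by
  let L : H →L⋆[ℂ] H →L[ℂ] ℂ :=
    (LinearMap.mk₂'ₛₗ (starRingEnd ℂ) (RingHom.id ℂ) B h₁ h₂ h₃ h₄).mkContinuous₂ C hB
  refine ⟨ContinuousLinearMap.adjoint (continuousLinearMapOfBilin L), fun η ξ => ?_⟩
  rw [ContinuousLinearMap.adjoint_inner_right, continuousLinearMapOfBilin_apply]
  rfl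

theorem eq_of_forall_norm_sub_le {a b : ℂ} {C : ℝ} (hC : 0 ≤ C)
    (h : ∀ ε > 0, ‖a - b‖ ≤ C * ε) : a = b := by
  rw [← sub_eq_zero, ← norm_le_zero_iff]
  refine le_of_forall_pos_le_add fun ε hε => ?_
  refine (h (ε / (C + 1)) (by positivity)).trans ?_
  rw [zero_add, ← mul_div_assoc, div_le_iff₀ (by positivity)]
  nlinarith

/-- A bounded functional on `B(H)` is given on approximable operators by a trace-class operator. -/
theorem exists_traceClass_of_dual (ψ : StrongDual ℂ (H →L[ℂ] H)) :
    ∃ x : H →L[ℂ] H, traceNorm x ≤ ENNReal.ofReal ‖ψ‖ ∧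
      ∀ T : H →L[ℂ] H, IsApproximable T → ψ T = trace (T * x) := by
  obtain ⟨x, hx⟩ := exists_op_of_form (fun η ξ => ψ (rankOne ℂ ξ η)) ‖ψ‖
    (fun η ξ => by
      refine (ψ.le_opNorm _).trans_eq ?_
      rw [norm_rankOne]; ring)
    (by simp) (by simp) (by simp) (by simp)
  have hnorm : traceNorm x ≤ ENNReal.ofReal ‖ψ‖ := by
    obtain ⟨U, hU, -, hA⟩ := exists_polar x
    have hpos : 0 ≤ CFC.sqrt (star x * x) := CFC.sqrt_nonneg _
    rw [traceNorm, posTrace, ENNReal.tsum_eq_iSup_sum]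
    refine iSup_le fun s => ?_
    rw [← ENNReal.ofReal_sum_of_nonneg fun i _ =>
      (ContinuousLinearMap.nonneg_iff_isPositive _ |>.1 hpos).re_inner_nonneg_right _]
    refine ENNReal.ofReal_le_ofReal ?_
    -- Testing `ψ` on the finite-rank contraction `P_s U*` produces a partial sum of `Tr |x|`.
    have h1 : ∑ i ∈ s, RCLike.re ⟪basis H i, CFC.sqrt (star x * x) (basis H i)⟫_ℂ =
        RCLike.re (ψ (frameProj s (basis H) * star U)) := by
      rw [frameProj_mul, star_star, map_sum, map_sum]
      refine Finset.sum_congr rfl fun i _ => ?_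
      rw [← hx, hA, mul_apply_eq_comp, ContinuousLinearMap.star_eq_adjoint,
        ContinuousLinearMap.adjoint_inner_right]
    rw [h1]
    calc RCLike.re (ψ (frameProj s (basis H) * star U))
        ≤ ‖ψ (frameProj s (basis H) * star U)‖ := RCLike.re_le_norm _
      _ ≤ ‖ψ‖ * ‖frameProj s (basis H) * star U‖ := ψ.le_opNorm _
      _ ≤ ‖ψ‖ * 1 := by
          gcongr
          refine (norm_mul_le _ _).trans (mul_le_one₀ ?_ (norm_nonneg _) (by rwa [norm_star]))
          exact norm_frameProj_le (basis H).orthonormal s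
      _ = ‖ψ‖ := mul_one _
  have hxt : IsTraceClass x := hnorm.trans_lt ENNReal.ofReal_lt_top
  refine ⟨x, hnorm, fun T hT => ?_⟩
  refine eq_of_forall_norm_sub_le (C := ‖ψ‖ + (traceNorm x).toReal)
    (add_nonneg (norm_nonneg _) ENNReal.toReal_nonneg) fun ε hε => ?_
  obtain ⟨t, a, b, h⟩ := hT ε hε
  set S := ∑ i ∈ t, rankOne ℂ (a i) (b i) with hS
  have hSx : ψ S = trace (S * x) := by
    rw [hS, trace_sum_rankOne_mul, map_sum]
    exact Finset.sum_congr rfl fun i _ => (hx _ _).symm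
  -- Both sides agree on the finite-rank operator `S`, and both are continuous in the operator norm.
  have e : ψ T - trace (T * x) = ψ (T - S) - trace ((T - S) * x) := by
    rw [map_sub, sub_mul, (hxt.mul_left T).trace_sub (hxt.mul_left S), hSx]
    ring
  have h1 : ‖trace ((T - S) * x)‖ ≤ ‖T - S‖ * (traceNorm x).toReal := by
    have := (enorm_trace_le _).trans (traceNorm_mul_le (T - S) x)
    have h2 := ENNReal.toReal_mono (ENNReal.mul_lt_top enorm_lt_top hxt).ne this
    rwa [ENNReal.toReal_mul, toReal_enorm, toReal_enorm] at h2
  rw [e]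
  calc _ ≤ ‖ψ‖ * ‖T - S‖ + ‖T - S‖ * (traceNorm x).toReal :=
        (norm_sub_le _ _).trans (add_le_add (ψ.le_opNorm _) h1)
    _ = (‖ψ‖ + (traceNorm x).toReal) * ‖T - S‖ := by ring
    _ ≤ _ := by gcongr

theorem hsSum_mul_frameProj_basis (y : H →L[ℂ] H) (s : Finset (basisSet H)) :
    hsSum (basis H) (y * frameProj s (basis H)) =
      ENNReal.ofReal (∑ i ∈ s, ‖y (basis H i)‖ ^ 2) := by
  have h1 : ∀ i ∈ s, frameProj s (basis H) (basis H i) = basis H i := by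
    intro i hi
    rw [frameProj_apply, Finset.sum_eq_single i, inner_self_eq_norm_sq_to_K,
      (basis H).orthonormal.1 i]
    · simp
    · intro j _ hj
      rw [(basis H).orthonormal.2 hj, zero_smul]
    · exact fun h => absurd hi h
  have h2 : ∀ i ∉ s, frameProj s (basis H) (basis H i) = 0 := by
    intro i hi
    rw [frameProj_apply]
    refine Finset.sum_eq_zero fun j hj => ?_
    rw [(basis H).orthonormal.2 (fun e : j = i => hi (e ▸ hj)), zero_smul]
  rw [hsSum, tsum_eq_sum (s := s), ENNReal.ofReal_sum_of_nonneg fun i _ => by positivity]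
  · refine Finset.sum_congr rfl fun i hi => ?_
    rw [mul_apply_eq_comp, h1 i hi]
  · intro i hi
    rw [mul_apply_eq_comp, h2 i hi]
    simp

/-- A bounded functional on `C₂(H)` is given by a Hilbert--Schmidt operator. -/
theorem exists_hilbertSchmidt_of_dual (ψ : StrongDual ℂ (HilbertSchmidt H)) :
    ∃ y : H →L[ℂ] H, hsNorm y ≤ ENNReal.ofReal ‖ψ‖ ∧
      ∀ K : HilbertSchmidt H, ψ K = trace (K.toOp * y) := by
  let r : H → H → HilbertSchmidt H := fun ξ η =>
    HilbertSchmidt.ofOp (rankOne ℂ ξ η) (isHilbertSchmidt_rankOne ξ η)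
  have hr : ∀ ξ η, (r ξ η).toOp = rankOne ℂ ξ η := fun ξ η => rfl
  have hψ : ∀ K : HilbertSchmidt H, ‖ψ K‖ ≤ ‖ψ‖ * (hsNorm K.toOp).toReal := fun K =>
    ψ.le_opNorm K
  obtain ⟨y, hy⟩ := exists_op_of_form (fun η ξ => ψ (r ξ η)) ‖ψ‖
    (fun η ξ => by
      refine (hψ _).trans_eq ?_
      rw [hr, hsNorm_rankOne, ENNReal.toReal_ofReal (by positivity)]; ring)
    (fun η η' ξ => by
      rw [← map_add]; congr 1
      exact HilbertSchmidt.toOp_injective (by simp [hr]))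
    (fun c η ξ => by
      rw [← map_smul]; congr 1
      exact HilbertSchmidt.toOp_injective (by simp [hr]))
    (fun η ξ ξ' => by
      rw [← map_add]; congr 1
      exact HilbertSchmidt.toOp_injective (by simp [hr]))
    (fun c η ξ => by
      rw [← map_smul]; congr 1
      exact HilbertSchmidt.toOp_injective (by simp [hr]))
  have hsum : ∀ (s : Finset (basisSet H)) (v : basisSet H → H),
      (∑ i ∈ s, r (basis H i) (v i)).toOp = ∑ i ∈ s, rankOne ℂ (basis H i) (v i) := by
    intro s v
    rw [map_sum]
    rfl
  have hnorm : hsNorm y ≤ ENNReal.ofReal ‖ψ‖ := by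
    rw [hsNorm_le_iff, hsSum, ENNReal.tsum_eq_iSup_sum]
    refine iSup_le fun s => ?_
    rw [← ENNReal.ofReal_sum_of_nonneg fun i _ => by positivity,
      ← ENNReal.ofReal_pow (norm_nonneg _)]
    refine ENNReal.ofReal_le_ofReal ?_
    set q := ∑ i ∈ s, ‖y (basis H i)‖ ^ 2 with hq
    have hq0 : 0 ≤ q := by positivity
    -- The test operator is `P_s y*`: `ψ` takes the value `q` on it and its norm is `√q`, hence `q ≤
    -- ‖ψ‖ √q`.
    have h1 : ψ (∑ i ∈ s, r (basis H i) (y (basis H i))) = (q : ℂ) := by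
      rw [map_sum, hq]
      push_cast
      refine Finset.sum_congr rfl fun i _ => ?_
      rw [← hy, inner_self_eq_norm_sq_to_K]
      rfl
    have h2 : hsNorm (∑ i ∈ s, r (basis H i) (y (basis H i))).toOp = ENNReal.ofReal (√q) := by
      rw [hsum]
      have h3 := frameProj_mul s (basis H) (star y)
      rw [star_star] at h3
      have h4 : frameProj s (basis H) * star y = star (y * frameProj s (basis H)) := by
        rw [star_mul, star_frameProj]
      rw [← h3, h4, hsNorm_star, hsNorm_eq (basis H), hsSum_mul_frameProj_basis,
        ENNReal.ofReal_rpow_of_nonneg hq0 (by norm_num), Real.sqrt_eq_rpow]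
    have h5 := hψ (∑ i ∈ s, r (basis H i) (y (basis H i)))
    rw [h1, h2, Complex.norm_real, Real.norm_of_nonneg hq0,
      ENNReal.toReal_ofReal (Real.sqrt_nonneg _)] at h5
    have h6 := Real.mul_self_sqrt hq0
    rcases (Real.sqrt_nonneg q).eq_or_lt with h0 | h0
    · rw [← h6, ← h0, mul_zero]
      positivity
    · have h7 : √q ≤ ‖ψ‖ := by
        rw [← h6] at h5
        rw [Real.sqrt_mul_self (Real.sqrt_nonneg q)] at h5
        exact le_of_mul_le_mul_right h5 h0
      rw [← h6, sq]
      gcongr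
  have hyt : IsHilbertSchmidt y := hnorm.trans_lt ENNReal.ofReal_lt_top
  refine ⟨y, hnorm, fun K => ?_⟩
  have hsmall := tendsto_hsNorm_sub_frameProj_mul (fun _ : Finset (basisSet H) =>
    (basis H).orthonormal) tendsto_frameProj_basis K.isHilbertSchmidt
  have hlim := ((ENNReal.tendsto_toReal ENNReal.zero_ne_top).comp hsmall).const_mul
    (‖ψ‖ + (hsNorm y).toReal)
  rw [ENNReal.toReal_zero, mul_zero] at hlim
  rw [← sub_eq_zero, ← norm_le_zero_iff]
  refine ge_of_tendsto hlim (Eventually.of_forall fun s => ?_)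
  set S := ∑ i ∈ s, r (basis H i) (star K.toOp (basis H i)) with hS
  have hSop : S.toOp = frameProj s (basis H) * K.toOp := by
    rw [hS, hsum, frameProj_mul]
  have hSy : ψ S = trace (S.toOp * y) := by
    rw [hSop, frameProj_mul, trace_sum_rankOne_mul, hS, map_sum]
    exact Finset.sum_congr rfl fun i _ => (hy _ _).symm
  have e : ψ K - trace (K.toOp * y) = ψ (K - S) - trace ((K - S).toOp * y) := by
    rw [map_sub, map_sub, sub_mul, (K.isHilbertSchmidt.isTraceClass_mul hyt).trace_sub
      (S.isHilbertSchmidt.isTraceClass_mul hyt), hSy]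
    ring
  have h1 : ‖trace ((K - S).toOp * y)‖ ≤ (hsNorm (K - S).toOp).toReal * (hsNorm y).toReal := by
    have := (enorm_trace_le _).trans (traceNorm_mul_le_hsNorm_mul (K - S).toOp y)
    have h2 := ENNReal.toReal_mono
      (ENNReal.mul_lt_top (K - S).isHilbertSchmidt hyt).ne this
    rwa [ENNReal.toReal_mul, toReal_enorm] at h2
  rw [e]
  change _ ≤ (‖ψ‖ + (hsNorm y).toReal) *
    (hsNorm (K.toOp - frameProj s (basis H) * K.toOp)).toReal
  rw [← hSop, ← map_sub]
  calc _ ≤ ‖ψ‖ * (hsNorm (K - S).toOp).toReal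
        + (hsNorm (K - S).toOp).toReal * (hsNorm y).toReal :=
        (norm_sub_le _ _).trans (add_le_add (hψ _) h1)
    _ = _ := by ring

/-- Hahn--Banach along an isometric embedding. -/
theorem exists_dual_extension {E W : Type*} [NormedAddCommGroup E] [NormedSpace ℂ E]
    [NormedAddCommGroup W] [NormedSpace ℂ W] (j : E →ₗᵢ[ℂ] W) (φ : StrongDual ℂ E) :
    ∃ ψ : StrongDual ℂ W, (∀ T, ψ (j T) = φ T) ∧ ‖ψ‖ ≤ ‖φ‖ := by
  let f : StrongDual ℂ (LinearMap.range j.toLinearMap) :=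
    φ ∘L (j.equivRange.symm.toContinuousLinearEquiv : _ →L[ℂ] E)
  obtain ⟨ψ, h1, h2⟩ := exists_extension_norm_eq (LinearMap.range j.toLinearMap) f
  refine ⟨ψ, fun T => ?_, ?_⟩
  · have h3 := h1 (j.equivRange T)
    have h4 : f (j.equivRange T) = φ T :=
      congrArg φ (j.equivRange.symm_apply_apply T)
    rw [h4] at h3
    exact h3
  · rw [h2]
    refine ContinuousLinearMap.opNorm_le_bound _ (norm_nonneg _) fun w => ?_
    refine (φ.le_opNorm _).trans_eq ?_
    exact congrArg (‖φ‖ * ·) (j.equivRange.symm.norm_map w)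

end Duality

/-! ### The isometric pairing with `KΛ(Ω)`. -/

section Main

variable {Ω : Set ℂ}

/-! ### The predual pairing -/

theorem KLambda.isApproximable (T : KLambda Ω) : IsApproximable T.toOp :=
  IsCompactOperator.isApproximable T.isCompactOperator

theorem KLambda.norm_eq (hm : MeasurableSet Ω) (hb : Bornology.IsBounded Ω) (T : KLambda Ω) :
    ‖T‖ = ‖T.toOp‖ + (hsNorm (comm (opZ hm hb) T.toOp)).toReal := by
  rw [KLambda.norm_def, lipNorm_eq hm hb T.isApproximable]

theorem KLambda.isHilbertSchmidt_comm (hm : MeasurableSet Ω) (hb : Bornology.IsBounded Ω)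
    (T : KLambda Ω) : IsHilbertSchmidt (comm (opZ hm hb) T.toOp) := by
  rw [IsHilbertSchmidt, ← lipNorm_eq hm hb T.isApproximable]
  exact T.lipNorm_lt_top

theorem isTraceClass_pairing (hm : MeasurableSet Ω) (hb : Bornology.IsBounded Ω) (T : KLambda Ω)
    (x : TraceClass (L2 Ω)) (y : HilbertSchmidt (L2 Ω)) :
    IsTraceClass (T.toOp * x.toOp + comm (opZ hm hb) T.toOp * y.toOp) :=
  (x.isTraceClass.mul_left _).add
    ((T.isHilbertSchmidt_comm hm hb).isTraceClass_mul y.isHilbertSchmidt)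

theorem trace_pairing (hm : MeasurableSet Ω) (hb : Bornology.IsBounded Ω) (T : KLambda Ω)
    (x : TraceClass (L2 Ω)) (y : HilbertSchmidt (L2 Ω)) :
    trace (T.toOp * x.toOp + comm (opZ hm hb) T.toOp * y.toOp) =
      trace (T.toOp * x.toOp) + trace (comm (opZ hm hb) T.toOp * y.toOp) :=
  (x.isTraceClass.mul_left _).trace_add
    ((T.isHilbertSchmidt_comm hm hb).isTraceClass_mul y.isHilbertSchmidt)

/-- The maximum norm on `C₁ × C₂` matches the sum `‖T‖ + |[Z, T]|₂`, so the bound has constant one.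
-/
theorem norm_trace_pairing_le (hm : MeasurableSet Ω) (hb : Bornology.IsBounded Ω) (T : KLambda Ω)
    (p : TraceClass (L2 Ω) × HilbertSchmidt (L2 Ω)) :
    ‖trace (T.toOp * p.1.toOp + comm (opZ hm hb) T.toOp * p.2.toOp)‖ ≤ 1 * ‖p‖ * ‖T‖ := by
  have hT := T.isHilbertSchmidt_comm hm hb
  have h1 : ‖trace (T.toOp * p.1.toOp)‖ ≤ ‖T.toOp‖ * ‖p.1‖ := by
    have h := ENNReal.toReal_mono (ENNReal.mul_lt_top enorm_lt_top p.1.isTraceClass).ne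
      ((enorm_trace_le _).trans (traceNorm_mul_le T.toOp p.1.toOp))
    rwa [ENNReal.toReal_mul, toReal_enorm, toReal_enorm] at h
  have h2 : ‖trace (comm (opZ hm hb) T.toOp * p.2.toOp)‖ ≤
      (hsNorm (comm (opZ hm hb) T.toOp)).toReal * ‖p.2‖ := by
    have h := ENNReal.toReal_mono (ENNReal.mul_lt_top hT p.2.isHilbertSchmidt).ne
      ((enorm_trace_le _).trans (traceNorm_mul_le_hsNorm_mul _ _))
    rwa [ENNReal.toReal_mul, toReal_enorm] at h
  rw [trace_pairing, T.norm_eq hm hb]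
  refine (norm_add_le _ _).trans ((add_le_add h1 h2).trans ?_)
  rw [one_mul, mul_add, mul_comm ‖T.toOp‖, mul_comm (hsNorm _).toReal]
  have := ENNReal.toReal_nonneg (a := hsNorm (comm (opZ hm hb) T.toOp))
  gcongr
  · exact norm_fst_le p
  · exact norm_snd_le p

/-- The pairing `(T, (x, y)) ↦ Tr (T x + [Z, T] y)`. -/
noncomputable def pairing (hm : MeasurableSet Ω) (hb : Bornology.IsBounded Ω) :
    TraceClass (L2 Ω) × HilbertSchmidt (L2 Ω) →L[ℂ] StrongDual ℂ (KLambda Ω) :=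
  (LinearMap.mk₂ ℂ (fun (p : TraceClass (L2 Ω) × HilbertSchmidt (L2 Ω)) (T : KLambda Ω) =>
      trace (T.toOp * p.1.toOp + comm (opZ hm hb) T.toOp * p.2.toOp))
    (fun p q T => by
      rw [← (isTraceClass_pairing hm hb T p.1 p.2).trace_add
        (isTraceClass_pairing hm hb T q.1 q.2)]
      simp only [Prod.fst_add, Prod.snd_add, map_add, mul_add]
      congr 1
      abel)
    (fun c p T => by
      rw [smul_eq_mul, ← trace_smul]
      simp only [Prod.smul_fst, Prod.smul_snd, map_smul, mul_smul_comm, smul_add])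
    (fun p S T => by
      rw [← (isTraceClass_pairing hm hb S p.1 p.2).trace_add
        (isTraceClass_pairing hm hb T p.1 p.2)]
      simp only [map_add, comm_add, add_mul]
      congr 1
      abel)
    (fun c p T => by
      rw [smul_eq_mul, ← trace_smul]
      simp only [map_smul, comm_smul, smul_mul_assoc, smul_add])).mkContinuous₂ 1
    fun p T => norm_trace_pairing_le hm hb T p

theorem pairing_apply (hm : MeasurableSet Ω) (hb : Bornology.IsBounded Ω)
    (p : TraceClass (L2 Ω) × HilbertSchmidt (L2 Ω)) (T : KLambda Ω) :
    pairing hm hb p T = trace (T.toOp * p.1.toOp + comm (opZ hm hb) T.toOp * p.2.toOp) := rfl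

theorem norm_pairing_le (hm : MeasurableSet Ω) (hb : Bornology.IsBounded Ω)
    (p : TraceClass (L2 Ω) × HilbertSchmidt (L2 Ω)) : ‖pairing hm hb p‖ ≤ ‖p‖ := by
  refine ContinuousLinearMap.opNorm_le_bound _ (norm_nonneg _) fun T => ?_
  have := norm_trace_pairing_le hm hb T p
  rwa [one_mul] at this

theorem isCompactOperator_rankOne {H : Type*} [NormedAddCommGroup H] [InnerProductSpace ℂ H]
    (a b : H) : IsCompactOperator (rankOne ℂ a b) := by
  have h := (isCompactOperator_of_locallyCompactSpace_dom (innerSL ℂ b)).clm_comp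
    (ContinuousLinearMap.toSpanSingleton ℂ a)
  exact h

/-- A rank-one operator as an element of `KΛ(Ω)`. -/
theorem exists_kLambda_rankOne (hm : MeasurableSet Ω) (hb : Bornology.IsBounded Ω) (a b : L2 Ω) :
    ∃ T : KLambda Ω, T.toOp = rankOne ℂ a b := by
  refine ⟨⟨rankOne ℂ a b, ?_, isCompactOperator_rankOne a b⟩, rfl⟩
  change lipNorm (rankOne ℂ a b) < ∞
  rw [lipNorm_eq hm hb (IsCompactOperator.isApproximable (isCompactOperator_rankOne a b))]
  exact ((isHilbertSchmidt_rankOne a b).mul_left _).sub ((isHilbertSchmidt_rankOne a b).mul_right _)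

/-- Vanishing on all rank-one operators determines every matrix entry of `x - [Z, y]`. In the other
direction the paired operator is the commutator `[Z, Ty]`, which has trace zero. -/
theorem pairing_eq_zero_iff (hm : MeasurableSet Ω) (hb : Bornology.IsBounded Ω)
    (p : TraceClass (L2 Ω) × HilbertSchmidt (L2 Ω)) :
    pairing hm hb p = 0 ↔ p ∈ annN hm hb := by
  constructor
  · intro h
    change p.1.toOp = comm (opZ hm hb) p.2.toOp
    refine ContinuousLinearMap.ext fun ξ => ext_inner_left ℂ fun η => ?_
    obtain ⟨T, hT⟩ := exists_kLambda_rankOne hm hb ξ η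
    have h1 : pairing hm hb p T = 0 := by rw [h]; rfl
    have hr := trace_sum_rankOne_mul {()} (fun _ => ξ) (fun _ => η)
    simp only [Finset.sum_singleton] at hr
    have hr' := trace_sum_rankOne_mul {()} (fun _ => opZ hm hb ξ) (fun _ => η)
    simp only [Finset.sum_singleton] at hr'
    have hHS := isHilbertSchmidt_rankOne ξ η
    have hHS' := isHilbertSchmidt_rankOne (opZ hm hb ξ) η
    rw [pairing_apply, trace_pairing, hT, hr, comm, mul_rankOne, sub_mul,
      (hHS'.isTraceClass_mul p.2.isHilbertSchmidt).trace_sub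
        ((hHS.mul_right _).isTraceClass_mul p.2.isHilbertSchmidt), hr', mul_assoc, hr] at h1
    rw [comm, sub_apply, inner_sub_right]
    rw [mul_apply_eq_comp] at h1 ⊢
    rw [mul_apply_eq_comp]
    linear_combination h1
  · intro h
    have hp : p.1.toOp = comm (opZ hm hb) p.2.toOp := h
    refine ContinuousLinearMap.ext fun T => ?_
    have e : T.toOp * p.1.toOp + comm (opZ hm hb) T.toOp * p.2.toOp =
        comm (opZ hm hb) (T.toOp * p.2.toOp) := by
      rw [hp, comm, comm, comm]
      noncomm_ring
    have ht := isTraceClass_pairing hm hb T p.1 p.2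
    rw [pairing_apply, e]
    rw [e] at ht
    exact trace_comm_opZ_eq_zero hm hb (p.2.isHilbertSchmidt.mul_left _) ht

/-- The isometric embedding `T ↦ (T, [Z, T])`. -/
noncomputable def embedding (hm : MeasurableSet Ω) (hb : Bornology.IsBounded Ω) :
    KLambda Ω →ₗᵢ[ℂ] WithLp 1 (Op Ω × HilbertSchmidt (L2 Ω)) where
  toFun T := WithLp.toLp 1
    (T.toOp, HilbertSchmidt.ofOp (comm (opZ hm hb) T.toOp) (T.isHilbertSchmidt_comm hm hb))
  map_add' S T := by
    rw [← WithLp.toLp_add, Prod.mk_add_mk]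
    refine congrArg (WithLp.toLp 1) (Prod.ext ?_ ?_)
    · exact map_add _ _ _
    · refine HilbertSchmidt.toOp_injective ?_
      change comm _ (S + T).toOp = comm _ S.toOp + comm _ T.toOp
      rw [map_add, comm_add]
  map_smul' c T := by
    rw [RingHom.id_apply, ← WithLp.toLp_smul, Prod.smul_mk]
    refine congrArg (WithLp.toLp 1) (Prod.ext ?_ ?_)
    · exact map_smul _ _ _
    · refine HilbertSchmidt.toOp_injective ?_
      change comm _ (c • T).toOp = c • comm _ T.toOp
      rw [map_smul, comm_smul]
  norm_map' T := by
    rw [T.norm_eq hm hb]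
    exact WithLp.prod_norm_eq_of_L1 _

/-- Extend the functional along `T ↦ (T, [Z, T])` and restrict the extension to the two summands.
The `ℓ¹` norm on the sum is what bounds both restrictions by `‖φ‖`, and hence the maximum norm of
the representing pair. -/
theorem exists_pairing_eq (hm : MeasurableSet Ω) (hb : Bornology.IsBounded Ω)
    (φ : StrongDual ℂ (KLambda Ω)) :
    ∃ p : TraceClass (L2 Ω) × HilbertSchmidt (L2 Ω), pairing hm hb p = φ ∧ ‖p‖ ≤ ‖φ‖ := by
  obtain ⟨ψ, hψ, hnorm⟩ := exists_dual_extension (embedding hm hb) φ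
  have hin1 : ∀ S : Op Ω, ‖ψ (WithLp.toLp 1 (S, 0))‖ ≤ ‖φ‖ * ‖S‖ := by
    intro S
    refine (ψ.le_of_opNorm_le hnorm _).trans_eq ?_
    rw [WithLp.prod_norm_eq_of_L1]
    simp
  have hin2 : ∀ K : HilbertSchmidt (L2 Ω), ‖ψ (WithLp.toLp 1 (0, K))‖ ≤ ‖φ‖ * ‖K‖ := by
    intro K
    refine (ψ.le_of_opNorm_le hnorm _).trans_eq ?_
    rw [WithLp.prod_norm_eq_of_L1]
    simp
  let ψ₁ : StrongDual ℂ (Op Ω) := LinearMap.mkContinuous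
    { toFun := fun S => ψ (WithLp.toLp 1 (S, 0))
      map_add' := fun S S' => by
        rw [← map_add, ← WithLp.toLp_add, Prod.mk_add_mk, add_zero]
      map_smul' := fun c S => by
        rw [RingHom.id_apply, ← map_smul, ← WithLp.toLp_smul, Prod.smul_mk, smul_zero] } ‖φ‖ hin1
  let ψ₂ : StrongDual ℂ (HilbertSchmidt (L2 Ω)) := LinearMap.mkContinuous
    { toFun := fun K => ψ (WithLp.toLp 1 (0, K))
      map_add' := fun K K' => by
        rw [← map_add, ← WithLp.toLp_add, Prod.mk_add_mk, add_zero]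
      map_smul' := fun c K => by
        rw [RingHom.id_apply, ← map_smul, ← WithLp.toLp_smul, Prod.smul_mk, smul_zero] } ‖φ‖ hin2
  have hψ₁ : ‖ψ₁‖ ≤ ‖φ‖ := LinearMap.mkContinuous_norm_le _ (norm_nonneg _) _
  have hψ₂ : ‖ψ₂‖ ≤ ‖φ‖ := LinearMap.mkContinuous_norm_le _ (norm_nonneg _) _
  obtain ⟨x, hx, hx'⟩ := exists_traceClass_of_dual ψ₁
  obtain ⟨y, hy, hy'⟩ := exists_hilbertSchmidt_of_dual ψ₂
  refine ⟨(TraceClass.ofOp x (hx.trans_lt ENNReal.ofReal_lt_top),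
    HilbertSchmidt.ofOp y (hy.trans_lt ENNReal.ofReal_lt_top)), ?_, ?_⟩
  · refine ContinuousLinearMap.ext fun T => ?_
    rw [pairing_apply, trace_pairing]
    have h1 := hx' T.toOp T.isApproximable
    have h2 := hy' (HilbertSchmidt.ofOp (comm (opZ hm hb) T.toOp) (T.isHilbertSchmidt_comm hm hb))
    change trace (T.toOp * x) + trace (comm (opZ hm hb) T.toOp * y) = φ T
    rw [← h1]
    rw [HilbertSchmidt.toOp_ofOp] at h2
    rw [← h2, ← hψ T]
    change ψ (WithLp.toLp 1 _) + ψ (WithLp.toLp 1 _) = ψ (WithLp.toLp 1 _)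
    rw [← map_add, ← WithLp.toLp_add, Prod.mk_add_mk, add_zero, zero_add]
  · refine max_le ?_ ?_
    · exact (ENNReal.toReal_le_of_le_ofReal (norm_nonneg _) hx).trans hψ₁
    · exact (ENNReal.toReal_le_of_le_ofReal (norm_nonneg _) hy).trans hψ₂

theorem annN_le_ker_pairing (hm : MeasurableSet Ω) (hb : Bornology.IsBounded Ω) :
    annN hm hb ≤ LinearMap.ker (pairing hm hb).toLinearMap := fun p hp =>
  (pairing_eq_zero_iff hm hb p).2 hp

/-- The isometric isomorphism of `(C₁ × C₂) / N` onto the dual of `KΛ(Ω)`. -/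
noncomputable def dualEquiv (hm : MeasurableSet Ω) (hb : Bornology.IsBounded Ω) :
    ((TraceClass (L2 Ω) × HilbertSchmidt (L2 Ω)) ⧸ annN hm hb) ≃ₗᵢ[ℂ]
      StrongDual ℂ (KLambda Ω) where
  toLinearEquiv := LinearEquiv.ofBijective
    ((annN hm hb).liftQ (pairing hm hb).toLinearMap (annN_le_ker_pairing hm hb)) (by
    constructor
    · rw [← LinearMap.ker_eq_bot]
      refine Submodule.ker_liftQ_eq_bot _ _ _ fun p hp => ?_
      exact (pairing_eq_zero_iff hm hb p).1 hp
    · intro φ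
      obtain ⟨p, hp, -⟩ := exists_pairing_eq hm hb φ
      exact ⟨Submodule.Quotient.mk p, hp⟩)
  norm_map' q := by
    change ‖(annN hm hb).liftQ (pairing hm hb).toLinearMap (annN_le_ker_pairing hm hb) q‖ = ‖q‖
    refine le_antisymm ?_ ?_
    · refine le_of_forall_pos_le_add fun ε hε => ?_
      obtain ⟨p, rfl, hp⟩ := Submodule.Quotient.norm_mk_lt q hε
      exact (norm_pairing_le hm hb p).trans hp.le
    · obtain ⟨p, rfl⟩ := Submodule.Quotient.mk_surjective _ q
      -- `p'` defines the same functional as `p`, hence differs from it by an element of `N`, and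
      -- its norm is at most that of the functional.
      obtain ⟨p', hp', hn⟩ := exists_pairing_eq hm hb (pairing hm hb p)
      have h1 : (Submodule.Quotient.mk p : _ ⧸ annN hm hb) = Submodule.Quotient.mk p' := by
        rw [Submodule.Quotient.eq, ← pairing_eq_zero_iff, map_sub, hp', sub_self]
      rw [h1]
      refine (Submodule.Quotient.norm_mk_le _ p').trans (hn.trans_eq ?_)
      rw [← hp']
      rfl

end Main

end ELam

theorem mainTheorem6 (Ω : Set ℂ) (hm : MeasurableSet Ω) (hb : Bornology.IsBounded Ω) :
    (∀ (T : ELam.KLambda Ω) (x : ELam.TraceClass (ELam.L2 Ω))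
        (y : ELam.HilbertSchmidt (ELam.L2 Ω)),
      ELam.IsTraceClass (T.toOp * x.toOp + ELam.comm (ELam.opZ hm hb) T.toOp * y.toOp)) ∧
    ∃ Φ : ((ELam.TraceClass (ELam.L2 Ω) × ELam.HilbertSchmidt (ELam.L2 Ω)) ⧸ ELam.annN hm hb)
        ≃ₗᵢ[ℂ] StrongDual ℂ (ELam.KLambda Ω),
      ∀ (T : ELam.KLambda Ω) (x : ELam.TraceClass (ELam.L2 Ω))
        (y : ELam.HilbertSchmidt (ELam.L2 Ω)),
        Φ (Submodule.Quotient.mk (x, y)) T =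
          ELam.trace (T.toOp * x.toOp + ELam.comm (ELam.opZ hm hb) T.toOp * y.toOp) := by
  exact ⟨ELam.isTraceClass_pairing hm hb, ELam.dualEquiv hm hb, fun T x y => rfl⟩
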